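/- Let $(\xi_i)_{i\ge 1}$ be independent identically distributed real random variables with $E\xi_i=0$ and $\operatorname{Var}\xi_i=\sigma^2$, where $\sigma\in(0,\infty)$. Let $F$ be their distribution function, $f(t)=Ee^{it\xi_1}$ their characteristic function, $\Phi$ the standard normal distribution function, and $$\Phi_n(x)=P\Bigl\{\frac{\xi_1+\cdots+\xi_n}{\sigma\sqrt n}<x\Bigr\},\qquad H(x)=F(x\sigma)-\Phi(x).$$ Write $dH$ for the signed measure generated by $H$ and $|dH|$ for its total variation measure. Let $m\ge 3$ be an integer and suppose that (i) $A=\int_{\mathbb R}|f(t)|\,dt<\infty$; (ii) the pseudomoments $\mu_k=\int_{\mathbb R}x^k\,dH(x)$, $k=3,\dots,m$, exist (i.e. $\int_{\mathbb R}|x|^k\,|dH(x)|<\infty$) and are equal to $0$. For $n\ge 1$ put $$\nu_n^{(1)}(m)=\int_{|x|\le\sigma\sqrt n}|x|^{m+1}\,|dH(x)|,\qquad \nu_n^{(2)}(m)=\int_{|x|>\sigma\sqrt n}|x|^{m}\,|dH(x)|,\qquad \nu_n(m)=\max\{\nu_n^{(1)}(m),\nu_n^{(2)}(m)\},$$ and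 let $$C^{(1)}_m=\frac{12^{\frac{m+1}{2}}\,\Gamma\bigl(\frac{m+1}{2}\bigr)}{\pi\,(m+1)!},\qquad C^{(2)}_m=2C^{(1)}_{m-1},\qquad b=\exp\Bigl\{-\frac{\pi^2}{24A^2\sigma^2(2+\pi)^2}\Bigr\}.$$ Then $b<1$, and for every $n\ge 2$ such that $\nu_n(m)<\frac12e^{-3/2}$, $$\sup_{x\in\mathbb R}|\Phi_n(x)-\Phi(x)|\le 2C^{(1)}_m\frac{\nu_n^{(1)}(m)}{n^{\frac{m-1}{2}}}+2C^{(2)}_m\frac{\nu_n^{(2)}(m)}{n^{\frac{m-2}{2}}}+\frac{\sigma A}{\pi}\,b^{\,n-1}+\nu_n(m)\,\frac{4e^{3/2}}{\pi}\,\frac{e^{-n/2}}{n}.$$ -/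

import Mathlib

open MeasureTheory ProbabilityTheory

noncomputable section

namespace Pseudomoments

/-- The standard normal distribution function `Φ`. -/
def stdNormalCDF (x : ℝ) : ℝ := cdf (gaussianReal 0 1) x

/-- The signed measure `dH`, where `H x = F (x * σ) - Φ x` and `F` is the distribution function of
the law `L`: the image of `L` under `x ↦ x / σ` has distribution function `x ↦ F (x * σ)`. -/
def pseudoMeasure (L : Measure ℝ) [IsFiniteMeasure L] (σ : ℝ) : SignedMeasure ℝ :=
  (L.map (fun x => x / σ)).toSignedMeasure - (gaussianReal 0 1).toSignedMeasure

/-- `dH` gives the half line `(-∞, x]` the mass `H x = F (x * σ) - Φ x`. -/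
theorem pseudoMeasure_Iic (L : Measure ℝ) [IsProbabilityMeasure L] {σ : ℝ} (hσ : 0 < σ) (x : ℝ) :
    pseudoMeasure L σ (Set.Iic x) = cdf L (x * σ) - stdNormalCDF x := by
  have hpre : (fun y : ℝ => y / σ) ⁻¹' Set.Iic x = Set.Iic (x * σ) := by
    ext y
    simp [div_le_iff₀ hσ]
  rw [pseudoMeasure, Measure.toSignedMeasure_sub_apply measurableSet_Iic, stdNormalCDF,
    cdf_eq_real, cdf_eq_real, map_measureReal_apply (by fun_prop) measurableSet_Iic, hpre]

/-- The pseudomoment `μ_k = ∫ x ^ k dH(x)`. -/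
def pseudomoment (L : Measure ℝ) [IsFiniteMeasure L] (σ : ℝ) (k : ℕ) : ℝ :=
  (pseudoMeasure L σ).integral (fun x : ℝ => x ^ k) (ContinuousLinearMap.lsmul ℝ ℝ).flip

/-- `ν_n^{(1)}(m) = ∫_{|x| ≤ σ √n} |x| ^ (m + 1) |dH(x)|`. -/
def nu1 (L : Measure ℝ) [IsFiniteMeasure L] (σ : ℝ) (m n : ℕ) : ℝ :=
  ∫ x in {x : ℝ | |x| ≤ σ * √(n : ℝ)}, |x| ^ (m + 1) ∂(pseudoMeasure L σ).variation

/-- `ν_n^{(2)}(m) = ∫_{|x| > σ √n} |x| ^ m |dH(x)|`. -/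
def nu2 (L : Measure ℝ) [IsFiniteMeasure L] (σ : ℝ) (m n : ℕ) : ℝ :=
  ∫ x in {x : ℝ | σ * √(n : ℝ) < |x|}, |x| ^ m ∂(pseudoMeasure L σ).variation

/-- `ν_n(m) = max {ν_n^{(1)}(m), ν_n^{(2)}(m)}`. -/
def nu (L : Measure ℝ) [IsFiniteMeasure L] (σ : ℝ) (m n : ℕ) : ℝ :=
  max (nu1 L σ m n) (nu2 L σ m n)

/-- `C^{(1)}_m = 12 ^ ((m + 1) / 2) Γ((m + 1) / 2) / (π (m + 1)!)`. -/
def C1 (m : ℕ) : ℝ :=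
  (12 : ℝ) ^ (((m : ℝ) + 1) / 2) * Real.Gamma (((m : ℝ) + 1) / 2) /
    (Real.pi * ((m + 1).factorial : ℝ))

/-- `C^{(2)}_m = 2 C^{(1)}_{m-1}` (used for `m ≥ 3` only). -/
def C2 (m : ℕ) : ℝ := 2 * C1 (m - 1)

/-- `A = ∫ |f(t)| dt`, where `f` is the characteristic function of the law `L`. -/
def charFunL1 (L : Measure ℝ) : ℝ := ∫ t : ℝ, ‖charFun L t‖

/-- `b = exp (-π² / (24 A² σ² (2 + π)²))`. -/
def bConst (A σ : ℝ) : ℝ :=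
  Real.exp (-(Real.pi ^ 2 / (24 * A ^ 2 * σ ^ 2 * (2 + Real.pi) ^ 2)))

/-- The distribution function `Φ_n(x) = P (S_n < x)` of the normalized sum
`S_n = (σ √n)⁻¹ (ξ_1 + ⋯ + ξ_n)`; the sequence is indexed from `0`. -/
def sumCDF {Ω : Type*} [MeasurableSpace Ω] (P : Measure Ω) (ξ : ℕ → Ω → ℝ) (σ : ℝ) (n : ℕ)
    (x : ℝ) : ℝ :=
  P.real {ω | (σ * √(n : ℝ))⁻¹ * ∑ i ∈ Finset.range n, ξ i ω < x}

end Pseudomoments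

end

/-! Let `f` be the characteristic function of `ξ / σ` and `g s = exp (-s² / 2)` that of the standard
normal law. Esseen's smoothing inequality bounds the Kolmogorov distance between `Φ_n` and `Φ` by
`π⁻¹ ∫ |(f s ^ n - g s ^ n) / s| ds`, after the substitution `t = s √n`.

Where `2 ν_n ≤ g s`, the vanishing of the pseudomoments gives the Taylor-remainder bound
`|f s - g s| ≤ ν_n^{(1)} |s| ^ (m + 1) / (m + 1)! + 2 ν_n^{(2)} |s| ^ m / m!`, which is at most
`2 ν_n (exp (s² / 3) - 1)`. Hence `|f s| ≤ exp (-s² / 6)`, so the `n`-th powers differ by at most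
`n |f s - g s| exp (-n s² / 12)`, and the Gaussian moments of this bound are the terms with `C1`
and `C2`.

Elsewhere `|s| > 1`, and there `|f s| ≤ b`: if `|f|` were too close to `1` at `s`, it would be at
least `3 / 5` near many multiples of `s`, by the inequality `|sin (k x)| ≤ k |sin x|` applied to the
symmetrized law, and its integral would be too large. This gives the term with `b ^ (n - 1)`, and
the tail of `2 ν_n g ^ (n - 1)` gives the last one.
-/

/-! ### The Taylor remainder of the exponential -/

/-- The remainder of the exponential series after its first `n` terms. -/
noncomputable def expRemainder (n : ℕ) (z : ℂ) : ℂ :=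
  Complex.exp z - ∑ k ∈ Finset.range n, z ^ k / (k.factorial : ℂ)

theorem expRemainder_succ (n : ℕ) (z : ℂ) :
    expRemainder (n + 1) z = expRemainder n z - z ^ n / (n.factorial : ℂ) := by
  simp only [expRemainder, Finset.sum_range_succ]
  ring

theorem hasDerivAt_expRemainder_succ (n : ℕ) (z : ℂ) :
    HasDerivAt (expRemainder (n + 1)) (expRemainder n z) z := by
  induction n with
  | zero =>
    have hone : expRemainder 1 = fun w => Complex.exp w - 1 := by ext; simp [expRemainder]
    simpa [hone, expRemainder] using Complex.hasDerivAt_exp z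
  | succ n ih =>
    have h := ih.sub ((hasDerivAt_pow (n + 1) z).div_const ((n + 1).factorial : ℂ))
    refine (h.congr_deriv ?_).congr_of_eventuallyEq
      (.of_forall fun w => expRemainder_succ (n + 1) w)
    have h1 : (n.factorial : ℂ) ≠ 0 := by exact_mod_cast n.factorial_ne_zero
    have h2 : (n : ℂ) + 1 ≠ 0 := by exact_mod_cast n.succ_ne_zero
    rw [expRemainder_succ, Nat.factorial_succ]
    push_cast
    field_simp

theorem norm_expRemainder_le (n : ℕ) {z : ℂ} (hz : z.re ≤ 0) :
    ‖expRemainder n z‖ ≤ ‖z‖ ^ n / n.factorial := by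
  induction n generalizing z with
  | zero => simpa [expRemainder, Complex.norm_exp] using hz
  | succ n ih =>
    have hderiv (u : ℝ) :
        HasDerivAt (fun v : ℝ => expRemainder (n + 1) (v * z)) (expRemainder n (u * z) * z) u := by
      have hlin : HasDerivAt (fun v : ℝ => (v : ℂ) * z) z u := by
        simpa using Complex.ofRealCLM.hasDerivAt.mul_const z
      exact (hasDerivAt_expRemainder_succ n _).comp u hlin
    have hboundary (u : ℝ) :
        HasDerivAt (fun v : ℝ => v ^ (n + 1) * ‖z‖ ^ (n + 1) / (n + 1).factorial)
          (u ^ n * ‖z‖ ^ (n + 1) / n.factorial) u := by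
      refine (((hasDerivAt_pow (n + 1) u).mul_const _).div_const _).congr_deriv ?_
      rw [Nat.factorial_succ]
      push_cast
      field_simp
    have h := image_norm_le_of_norm_deriv_right_le_deriv_boundary (a := 0) (b := 1)
      (fun u _ => (hderiv u).continuousAt.continuousWithinAt)
      (fun u _ => (hderiv u).hasDerivWithinAt)
      (by simp [expRemainder, Finset.sum_range_succ']) hboundary ?_ ⟨zero_le_one, le_rfl⟩
    · simpa using h
    · rintro u ⟨hu, -⟩
      have hre : ((u : ℂ) * z).re ≤ 0 := by simpa using mul_nonpos_of_nonneg_of_nonpos hu hz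
      calc ‖expRemainder n (u * z) * z‖
          ≤ ‖(u : ℂ) * z‖ ^ n / n.factorial * ‖z‖ := by
            rw [norm_mul]
            exact mul_le_mul_of_nonneg_right (ih hre) (norm_nonneg z)
        _ = u ^ n * ‖z‖ ^ (n + 1) / n.factorial := by
            rw [norm_mul, Complex.norm_of_nonneg hu]
            ring

theorem norm_expRemainder_succ_le (n : ℕ) {z : ℂ} (hz : z.re ≤ 0) :
    ‖expRemainder (n + 1) z‖ ≤ 2 * (‖z‖ ^ n / n.factorial) := by
  have hterm : ‖z ^ n / (n.factorial : ℂ)‖ = ‖z‖ ^ n / n.factorial := by simp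
  rw [expRemainder_succ]
  linarith [norm_sub_le (expRemainder n z) (z ^ n / (n.factorial : ℂ)), norm_expRemainder_le n hz]

/-! ### Laws with matching moments -/

section Variation

variable {X : Type*} [MeasurableSpace X] {μ ν : Measure X} [IsFiniteMeasure μ] [IsFiniteMeasure ν]

theorem variation_toSignedMeasure_sub_le :
    (μ.toSignedMeasure - ν.toSignedMeasure).variation ≤ μ + ν :=
  VectorMeasure.variation_sub_le.trans (by simp)

theorem le_variation_toSignedMeasure_sub_add :
    μ ≤ (μ.toSignedMeasure - ν.toSignedMeasure).variation + ν := by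
  have h := VectorMeasure.variation_add_le (μ := μ.toSignedMeasure - ν.toSignedMeasure)
    (ν := ν.toSignedMeasure)
  simpa using h

theorem isFiniteMeasure_variation_toSignedMeasure_sub :
    IsFiniteMeasure (μ.toSignedMeasure - ν.toSignedMeasure).variation :=
  isFiniteMeasure_of_le (μ + ν) variation_toSignedMeasure_sub_le

theorem integrable_variation_toSignedMeasure_sub {E : Type*} [NormedAddCommGroup E] {f : X → E}
    (hμ : Integrable f μ) (hν : Integrable f ν) :
    Integrable f (μ.toSignedMeasure - ν.toSignedMeasure).variation :=
  (integrable_add_measure.2 ⟨hμ, hν⟩).mono_measure variation_toSignedMeasure_sub_le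

theorem norm_integral_sub_integral_le_variation {f : X → ℂ} (hμ : Integrable f μ)
    (hν : Integrable f ν) :
    ‖∫ x, f x ∂μ - ∫ x, f x ∂ν‖ ≤
      ∫ x, ‖f x‖ ∂(μ.toSignedMeasure - ν.toSignedMeasure).variation := by
  have h := VectorMeasure.norm_integral_le_integral_norm (f := f)
    (μ := μ.toSignedMeasure - ν.toSignedMeasure)
    (B := (ContinuousLinearMap.lsmul ℝ ℝ (E := ℂ)).flip)
  rw [VectorMeasure.integral_sub_vectorMeasure (by simpa [VectorMeasure.Integrable])
    (by simpa [VectorMeasure.Integrable]), VectorMeasure.integral_toSignedMeasure,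
    VectorMeasure.integral_toSignedMeasure] at h
  refine h.trans (mul_le_of_le_one_left (by positivity) ?_)
  rw [ContinuousLinearMap.opNorm_flip]
  exact ContinuousLinearMap.opNorm_lsmul_le

end Variation

section Moments

variable {μ ν : Measure ℝ}

theorem integrable_abs_pow {k : ℕ} (hμ : Integrable (fun x : ℝ => x ^ k) μ) :
    Integrable (fun x : ℝ => |x| ^ k) μ := by
  simpa only [norm_pow, Real.norm_eq_abs] using hμ.norm

theorem integrable_mul_I_pow_div_factorial {k : ℕ} (hμ : Integrable (fun x : ℝ => x ^ k) μ)
    (t : ℝ) :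
    Integrable (fun x : ℝ => ((t * x * Complex.I) ^ k / k.factorial : ℂ)) μ := by
  refine (hμ.ofReal.const_mul ((t * Complex.I) ^ k / (k.factorial : ℂ))).congr
    (.of_forall fun x => ?_)
  simp only [mul_pow, RCLike.ofReal_pow, Complex.coe_algebraMap]
  ring

theorem integral_mul_I_pow_div_factorial (k : ℕ) (t : ℝ) :
    ∫ x : ℝ, ((t * x * Complex.I) ^ k / k.factorial : ℂ) ∂μ =
      (t * Complex.I) ^ k / k.factorial * (∫ x, x ^ k ∂μ : ℝ) := by
  rw [← integral_complex_ofReal, ← integral_const_mul]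
  congr 1 with x
  push_cast
  ring

variable [IsFiniteMeasure μ] [IsFiniteMeasure ν]

theorem integrable_exp_mul_I (t : ℝ) :
    Integrable (fun x : ℝ => Complex.exp (t * x * Complex.I)) μ := by
  refine .of_bound (C := 1) (by fun_prop) (.of_forall fun x => ?_)
  rw [← Complex.ofReal_mul, Complex.norm_exp_ofReal_mul_I]

theorem integrable_expRemainder {n : ℕ} (hμ : ∀ k < n, Integrable (fun x : ℝ => x ^ k) μ)
    (t : ℝ) :
    Integrable (fun x : ℝ => expRemainder n (t * x * Complex.I)) μ :=
  (integrable_exp_mul_I t).sub <| integrable_finsetSum _ fun k hk =>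
    integrable_mul_I_pow_div_factorial (hμ k (Finset.mem_range.1 hk)) t

theorem integral_expRemainder {n : ℕ} (hμ : ∀ k < n, Integrable (fun x : ℝ => x ^ k) μ)
    (t : ℝ) :
    ∫ x : ℝ, expRemainder n (t * x * Complex.I) ∂μ =
      charFun μ t - ∑ k ∈ Finset.range n,
        (t * Complex.I) ^ k / k.factorial * (∫ x, x ^ k ∂μ : ℝ) := by
  have hterm : ∀ k ∈ Finset.range n, Integrable
      (fun x : ℝ => ((t * x * Complex.I) ^ k / k.factorial : ℂ)) μ := fun k hk =>
    integrable_mul_I_pow_div_factorial (hμ k (Finset.mem_range.1 hk)) t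
  simp only [expRemainder]
  rw [integral_sub (integrable_exp_mul_I t) (integrable_finsetSum _ hterm),
    integral_finsetSum _ hterm, charFun_apply_real]
  simp only [integral_mul_I_pow_div_factorial]

theorem charFun_sub_charFun_eq_integral_expRemainder {n : ℕ}
    (hμ : ∀ k < n, Integrable (fun x : ℝ => x ^ k) μ)
    (hν : ∀ k < n, Integrable (fun x : ℝ => x ^ k) ν)
    (hmoment : ∀ k < n, ∫ x, x ^ k ∂μ = ∫ x, x ^ k ∂ν) (t : ℝ) :
    charFun μ t - charFun ν t = ∫ x : ℝ, expRemainder n (t * x * Complex.I) ∂μ -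
      ∫ x : ℝ, expRemainder n (t * x * Complex.I) ∂ν := by
  rw [integral_expRemainder hμ, integral_expRemainder hν,
    Finset.sum_congr rfl fun k hk => by rw [hmoment k (Finset.mem_range.1 hk)]]
  ring

theorem integrableOn_abs_pow_abs_le (K : ℝ) (k : ℕ) :
    IntegrableOn (fun x : ℝ => |x| ^ k) {x | |x| ≤ K} μ := by
  refine Measure.integrableOn_of_bounded (M := K ^ k) (measure_ne_top _ _) (by fun_prop) ?_
  refine (ae_restrict_iff' (measurableSet_le (by fun_prop) (by fun_prop))).2
    (.of_forall fun x hx => ?_)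
  rw [norm_pow, Real.norm_eq_abs, abs_abs]
  exact pow_le_pow_left₀ (abs_nonneg x) hx k

theorem integral_norm_expRemainder_le {m : ℕ} (hμ : ∀ k ≤ m, Integrable (fun x : ℝ => x ^ k) μ)
    (K t : ℝ) :
    ∫ x : ℝ, ‖expRemainder (m + 1) (t * x * Complex.I)‖ ∂μ ≤
      (∫ x in {x : ℝ | |x| ≤ K}, |x| ^ (m + 1) ∂μ) * (|t| ^ (m + 1) / (m + 1).factorial) +
      (∫ x in {x : ℝ | K < |x|}, |x| ^ m ∂μ) * (2 * (|t| ^ m / m.factorial)) := by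
  have hR : Integrable (fun x : ℝ => ‖expRemainder (m + 1) (t * x * Complex.I)‖) μ :=
    (integrable_expRemainder (fun k hk => hμ k (Nat.lt_succ_iff.1 hk)) t).norm
  have hmeas : MeasurableSet {x : ℝ | |x| ≤ K} := measurableSet_le (by fun_prop) (by fun_prop)
  have hcompl : {x : ℝ | |x| ≤ K}ᶜ = {x : ℝ | K < |x|} := by ext; simp
  have hre (x : ℝ) : ((t : ℂ) * x * Complex.I).re ≤ 0 := by simp
  have hnorm (x : ℝ) (k : ℕ) : ‖(t : ℂ) * x * Complex.I‖ ^ k = |x| ^ k * |t| ^ k := by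
    simp [mul_pow, mul_comm]
  rw [← integral_add_compl hmeas hR, hcompl, ← integral_mul_const, ← integral_mul_const]
  refine add_le_add (integral_mono hR.integrableOn
      ((integrableOn_abs_pow_abs_le K (m + 1)).mul_const _) fun x => ?_)
    (integral_mono hR.integrableOn ((integrable_abs_pow (hμ m le_rfl)).integrableOn.mul_const _)
      fun x => ?_)
  · exact (norm_expRemainder_le (m + 1) (hre x)).trans_eq (by rw [hnorm, mul_div_assoc])
  · exact (norm_expRemainder_succ_le m (hre x)).trans_eq (by rw [hnorm]; ring)

/-- The bound that absolute pseudomoments `a₁` of order `m + 1` and `a₂` of order `m` impose at `t`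
on the difference of the characteristic functions of two laws whose moments agree up to order
`m`. -/
noncomputable def pseudomomentBound (m : ℕ) (a₁ a₂ t : ℝ) : ℝ :=
  a₁ * (|t| ^ (m + 1) / (m + 1).factorial) + a₂ * (2 * (|t| ^ m / m.factorial))

theorem norm_charFun_sub_charFun_le {m : ℕ}
    (hμ : ∀ k ≤ m, Integrable (fun x : ℝ => x ^ k) μ)
    (hν : ∀ k ≤ m, Integrable (fun x : ℝ => x ^ k) ν)
    (hmoment : ∀ k ≤ m, ∫ x, x ^ k ∂μ = ∫ x, x ^ k ∂ν) (K t : ℝ) :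
    ‖charFun μ t - charFun ν t‖ ≤ pseudomomentBound m
      (∫ x in {x | |x| ≤ K}, |x| ^ (m + 1) ∂(μ.toSignedMeasure - ν.toSignedMeasure).variation)
      (∫ x in {x | K < |x|}, |x| ^ m ∂(μ.toSignedMeasure - ν.toSignedMeasure).variation) t := by
  have := isFiniteMeasure_variation_toSignedMeasure_sub (μ := μ) (ν := ν)
  have hμ' : ∀ k < m + 1, Integrable (fun x : ℝ => x ^ k) μ := fun k hk => hμ k (by lia)
  have hν' : ∀ k < m + 1, Integrable (fun x : ℝ => x ^ k) ν := fun k hk => hν k (by lia)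
  rw [charFun_sub_charFun_eq_integral_expRemainder hμ' hν' fun k hk => hmoment k (by lia)]
  exact (norm_integral_sub_integral_le_variation (integrable_expRemainder hμ' t)
    (integrable_expRemainder hν' t)).trans (integral_norm_expRemainder_le
      (fun k hk => integrable_variation_toSignedMeasure_sub (hμ k hk) (hν k hk)) K t)

end Moments

/-! ### Esseen's smoothing inequality -/

section Smoothing

open scoped NNReal Topology
open Filter

theorem norm_exp_neg_ofReal_mul_I (t y : ℝ) : ‖Complex.exp (-(t * y * Complex.I))‖ = 1 := by
  have h := Complex.norm_exp_ofReal_mul_I (-(t * y))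
  push_cast at h
  rwa [neg_mul] at h

theorem norm_intervalIntegral_exp_le {t : ℝ} (ht : t ≠ 0) (a b : ℝ) :
    ‖∫ y in a..b, Complex.exp (-(t * y * Complex.I))‖ ≤ 2 / |t| := by
  have hc : -((t : ℂ) * Complex.I) ≠ 0 := by simp [ht]
  have hexp (y : ℝ) :
      Complex.exp (-(t * y * Complex.I)) = Complex.exp (-((t : ℂ) * Complex.I) * y) := by
    congr 1
    ring
  simp_rw [hexp]
  rw [integral_exp_mul_complex hc, ← hexp, ← hexp, norm_div]
  have hnorm : ‖-((t : ℂ) * Complex.I)‖ = |t| := by simp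
  rw [hnorm]
  gcongr
  refine (norm_sub_le _ _).trans_eq ?_
  rw [norm_exp_neg_ofReal_mul_I, norm_exp_neg_ofReal_mul_I]
  norm_num

theorem integral_charFun_sub (μ ρ : Measure ℝ) [IsFiniteMeasure μ] [IsFiniteMeasure ρ] (y : ℝ) :
    ∫ x, charFun ρ (x - y) ∂μ = ∫ t, Complex.exp (-(t * y * Complex.I)) * charFun μ t ∂ρ := by
  have hint : Integrable (Function.uncurry fun x t : ℝ =>
      Complex.exp (((x - y : ℝ) : ℂ) * t * Complex.I)) (μ.prod ρ) := by
    refine .of_bound (C := 1) ?_ (.of_forall fun p => ?_)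
    · exact Continuous.aestronglyMeasurable (by unfold Function.uncurry; fun_prop)
    simp only [Function.uncurry, ← Complex.ofReal_mul, Complex.norm_exp_ofReal_mul_I, le_refl]
  simp_rw [charFun_apply_real]
  rw [integral_integral_swap hint]
  congr 1 with t
  rw [← integral_const_mul]
  congr 1 with x
  rw [← Complex.exp_add]
  push_cast
  congr 1
  ring

theorem gaussianPDFReal_eq_charFun {v : ℝ≥0} (hv : v ≠ 0) (x y : ℝ) :
    (gaussianPDFReal x v y : ℂ) =
      ((√(2 * Real.pi * v))⁻¹ : ℝ) * charFun (gaussianReal 0 v⁻¹) (x - y) := by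
  have hv' : (v : ℂ) ≠ 0 := by exact_mod_cast hv
  rw [gaussianPDFReal_def, charFun_gaussianReal]
  push_cast
  congr 2
  field_simp
  ring

theorem gaussianPDFReal_le (μ : ℝ) (v : ℝ≥0) (x : ℝ) :
    gaussianPDFReal μ v x ≤ (√(2 * Real.pi * v))⁻¹ := by
  refine mul_le_of_le_one_right (by positivity) (Real.exp_le_one_iff.2 ?_)
  exact div_nonpos_of_nonpos_of_nonneg (neg_nonpos.2 (sq_nonneg _)) (by positivity)

theorem integral_gaussianReal_le {v : ℝ≥0} (hv : v ≠ 0) {f : ℝ → ℝ} (hf0 : ∀ t, 0 ≤ f t)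
    (hf : Integrable f) (μ : ℝ) :
    ∫ t, f t ∂(gaussianReal μ v) ≤ (√(2 * Real.pi * v))⁻¹ * ∫ t, f t := by
  rw [integral_gaussianReal_eq_integral_smul hv, ← integral_const_mul]
  exact integral_mono_of_nonneg
    (.of_forall fun t => mul_nonneg (gaussianPDFReal_nonneg _ _ _) (hf0 t)) (hf.const_mul _)
    (.of_forall fun t => mul_le_mul_of_nonneg_right (gaussianPDFReal_le μ v t) (hf0 t))

theorem integrable_gaussianReal {E : Type*} [NormedAddCommGroup E] [NormedSpace ℝ E]
    {v : ℝ≥0} (hv : v ≠ 0) {f : ℝ → E} (hf : Integrable f) (μ : ℝ) :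
    Integrable f (gaussianReal μ v) := by
  rw [gaussianReal_of_var_ne_zero μ hv,
    integrable_withDensity_iff_integrable_smul' (by fun_prop)
      (.of_forall fun _ => gaussianPDF_lt_top)]
  refine hf.bdd_smul (√(2 * Real.pi * v))⁻¹
    (measurable_gaussianPDF μ v).ennreal_toReal.aestronglyMeasurable (.of_forall fun t => ?_)
  rw [toReal_gaussianPDF, Real.norm_of_nonneg (gaussianPDFReal_nonneg _ _ _)]
  exact gaussianPDFReal_le μ v t

theorem measureReal_conv_gaussianReal (μ : Measure ℝ) [IsFiniteMeasure μ] {v : ℝ≥0} (hv : v ≠ 0)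
    {s : Set ℝ} (hs : MeasurableSet s) :
    (μ ∗ gaussianReal 0 v).real s = ∫ x, (∫ y in s, gaussianPDFReal x v y) ∂μ := by
  rw [← integral_indicator_one hs, integral_conv]
  · congr 1 with x
    have hshift : ∫ y, s.indicator (1 : ℝ → ℝ) (x + y) ∂(gaussianReal 0 v) =
        (gaussianReal (0 + x) v).real s := by
      rw [← gaussianReal_map_const_add, ← integral_indicator_one hs,
        integral_map (by fun_prop) (stronglyMeasurable_one.indicator hs).aestronglyMeasurable]
    rw [hshift, zero_add, measureReal_def, gaussianReal_apply_eq_integral x hv,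
      ENNReal.toReal_ofReal (integral_nonneg fun y => gaussianPDFReal_nonneg x v y)]
  · exact (integrable_const (1 : ℝ)).indicator hs

theorem measureReal_conv_gaussianReal_Ioc (μ : Measure ℝ) [IsFiniteMeasure μ] {v : ℝ≥0}
    (hv : v ≠ 0) {a b : ℝ} (hab : a ≤ b) :
    ((μ ∗ gaussianReal 0 v).real (Set.Ioc a b) : ℂ) = ((√(2 * Real.pi * v))⁻¹ : ℝ) *
      ∫ t, (∫ y in a..b, Complex.exp (-(t * y * Complex.I))) * charFun μ t
        ∂(gaussianReal 0 v⁻¹) := by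
  have hpdf : Integrable (Function.uncurry fun x y : ℝ => gaussianPDFReal x v y)
      (μ.prod (volume.restrict (Set.Ioc a b))) := by
    refine .of_bound (C := (√(2 * Real.pi * v))⁻¹) ?_ (.of_forall fun p => ?_)
    · simp only [gaussianPDFReal_def]
      exact Continuous.aestronglyMeasurable (by unfold Function.uncurry; fun_prop)
    · simpa only [Function.uncurry, Real.norm_of_nonneg (gaussianPDFReal_nonneg _ _ _)] using
        gaussianPDFReal_le p.1 v p.2
  have hexp : Integrable (Function.uncurry fun y t : ℝ =>
      Complex.exp (-(t * y * Complex.I)) * charFun μ t)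
      ((volume.restrict (Set.Ioc a b)).prod (gaussianReal 0 v⁻¹)) := by
    refine .of_bound (C := μ.real Set.univ) ?_ (.of_forall fun p => ?_)
    · exact Continuous.aestronglyMeasurable (by unfold Function.uncurry; fun_prop)
    · simpa only [Function.uncurry, norm_mul, norm_exp_neg_ofReal_mul_I, one_mul] using
        norm_charFun_le p.2
  rw [measureReal_conv_gaussianReal μ hv measurableSet_Ioc, integral_integral_swap hpdf,
    ← integral_complex_ofReal]
  simp_rw [← integral_complex_ofReal, gaussianPDFReal_eq_charFun hv, integral_const_mul,
    integral_charFun_sub]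
  rw [integral_integral_swap hexp]
  simp_rw [integral_mul_const, intervalIntegral.integral_of_le hab]

theorem integrable_intervalIntegral_exp_mul_charFun {μ ρ : Measure ℝ} [IsFiniteMeasure μ]
    [IsFiniteMeasure ρ] (a b : ℝ) :
    Integrable (fun t : ℝ =>
      (∫ y in a..b, Complex.exp (-(t * y * Complex.I))) * charFun μ t) ρ := by
  have hcont : Continuous fun t : ℝ => ∫ y in a..b, Complex.exp (-(t * y * Complex.I)) :=
    intervalIntegral.continuous_parametric_intervalIntegral_of_continuous' (by fun_prop) a b
  refine .of_bound (C := |b - a| * μ.real Set.univ)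
    (hcont.mul continuous_charFun).aestronglyMeasurable (.of_forall fun t => ?_)
  rw [norm_mul]
  gcongr
  · simpa using intervalIntegral.norm_integral_le_of_norm_le_const (a := a) (b := b)
      fun y _ => (norm_exp_neg_ofReal_mul_I t y).le
  · exact norm_charFun_le t

theorem norm_intervalIntegral_exp_mul_le (z : ℝ → ℂ) (hz : z 0 = 0) (a b t : ℝ) :
    ‖(∫ y in a..b, Complex.exp (-(t * y * Complex.I))) * z t‖ ≤ 2 * ‖z t / t‖ := by
  rcases eq_or_ne t 0 with rfl | ht
  · simp [hz]
  · calc _ ≤ 2 / |t| * ‖z t‖ := by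
          rw [norm_mul]
          exact mul_le_mul_of_nonneg_right (norm_intervalIntegral_exp_le ht a b) (norm_nonneg _)
      _ = 2 * ‖z t / t‖ := by
          rw [norm_div, Complex.norm_real, Real.norm_eq_abs]
          ring

theorem inv_sqrt_mul_inv_sqrt_inv_mul_two {v : ℝ≥0} (hv : v ≠ 0) :
    (√(2 * Real.pi * v))⁻¹ * (√(2 * Real.pi * (v⁻¹ : ℝ≥0)))⁻¹ * 2 = Real.pi⁻¹ := by
  have hsq : 2 * Real.pi * v * (2 * Real.pi * (v⁻¹ : ℝ≥0)) = (2 * Real.pi) ^ 2 := by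
    push_cast
    field_simp
  rw [← mul_inv, ← Real.sqrt_mul (by positivity), hsq, Real.sqrt_sq (by positivity)]
  field_simp

section TwoLaws

variable (μ ν : Measure ℝ) [IsProbabilityMeasure μ] [IsProbabilityMeasure ν]

theorem abs_measureReal_conv_gaussianReal_Ioc_sub_le
    (hint : Integrable fun t : ℝ => (charFun μ t - charFun ν t) / t) {v : ℝ≥0} (hv : v ≠ 0)
    {a b : ℝ} (hab : a ≤ b) :
    |(μ ∗ gaussianReal 0 v).real (Set.Ioc a b) - (ν ∗ gaussianReal 0 v).real (Set.Ioc a b)| ≤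
      (∫ t : ℝ, ‖(charFun μ t - charFun ν t) / t‖) / Real.pi := by
  set E : ℝ → ℂ := fun t => ∫ y in a..b, Complex.exp (-(t * y * Complex.I))
  set D : ℝ → ℂ := fun t => charFun μ t - charFun ν t
  have hE (κ : Measure ℝ) [IsProbabilityMeasure κ] :
      Integrable (fun t => E t * charFun κ t) (gaussianReal 0 v⁻¹) :=
    integrable_intervalIntegral_exp_mul_charFun a b
  have hED : ∀ t, ‖E t * D t‖ ≤ 2 * ‖D t / t‖ :=
    norm_intervalIntegral_exp_mul_le D (by simp [D]) a b
  rw [← Real.norm_eq_abs, ← Complex.norm_real, Complex.ofReal_sub,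
    measureReal_conv_gaussianReal_Ioc μ hv hab, measureReal_conv_gaussianReal_Ioc ν hv hab,
    ← mul_sub, ← integral_sub (hE μ) (hE ν), norm_mul, Complex.norm_of_nonneg (by positivity)]
  calc (√(2 * Real.pi * v))⁻¹ * ‖∫ t, (E t * charFun μ t - E t * charFun ν t)
          ∂(gaussianReal 0 v⁻¹)‖
      ≤ (√(2 * Real.pi * v))⁻¹ * ∫ t, 2 * ‖D t / t‖ ∂(gaussianReal 0 v⁻¹) := by
        gcongr
        refine norm_integral_le_of_norm_le
          ((integrable_gaussianReal (inv_ne_zero hv) hint 0).norm.const_mul 2)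
          (.of_forall fun t => ?_)
        rw [← mul_sub]
        exact hED t
    _ ≤ (√(2 * Real.pi * v))⁻¹ * ((√(2 * Real.pi * (v⁻¹ : ℝ≥0)))⁻¹ * ∫ t, 2 * ‖D t / t‖) := by
        gcongr
        exact integral_gaussianReal_le (inv_ne_zero hv) (fun t => by positivity)
          (hint.norm.const_mul 2) 0
    _ = (∫ t : ℝ, ‖D t / t‖) / Real.pi := by
        rw [integral_const_mul, div_eq_mul_inv, ← inv_sqrt_mul_inv_sqrt_inv_mul_two hv]
        ring

theorem abs_measureReal_conv_gaussianReal_Iic_sub_le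
    (hint : Integrable fun t : ℝ => (charFun μ t - charFun ν t) / t) {v : ℝ≥0} (hv : v ≠ 0)
    (x : ℝ) :
    |(μ ∗ gaussianReal 0 v).real (Set.Iic x) - (ν ∗ gaussianReal 0 v).real (Set.Iic x)| ≤
      (∫ t : ℝ, ‖(charFun μ t - charFun ν t) / t‖) / Real.pi := by
  have hlim (κ : Measure ℝ) [IsProbabilityMeasure κ] :
      Tendsto (fun a => κ.real (Set.Ioc a x)) atBot (𝓝 (κ.real (Set.Iic x))) :=
    (ENNReal.tendsto_toReal (measure_ne_top κ _)).comp (tendsto_measure_Ioc_atBot κ x)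
  refine le_of_tendsto ((hlim _).sub (hlim _)).abs ?_
  filter_upwards [eventually_le_atBot x] with a ha
  exact abs_measureReal_conv_gaussianReal_Ioc_sub_le μ ν hint hv ha

variable {μ ν}

theorem tendsto_measureReal_conv_gaussianReal_Iic {x : ℝ} (hx : μ {x} = 0) :
    Tendsto (fun n : ℕ => (μ ∗ gaussianReal 0 (1 / ((n : ℝ≥0) + 1))).real (Set.Iic x)) atTop
      (𝓝 (μ.real (Set.Iic x))) := by
  set μs : ℕ → ProbabilityMeasure ℝ := fun n =>
    ⟨μ ∗ gaussianReal 0 (1 / ((n : ℝ≥0) + 1)), inferInstance⟩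
  set μ₀ : ProbabilityMeasure ℝ := ⟨μ, inferInstance⟩
  have hlim : Tendsto μs atTop (𝓝 μ₀) := by
    refine ProbabilityMeasure.tendsto_of_tendsto_charFun fun t => ?_
    have hchar (n : ℕ) : charFun (μs n : Measure ℝ) t =
        charFun μ t * Complex.exp (-((1 / ((n : ℝ) + 1) : ℝ) * t ^ 2 / 2)) := by
      simp [μs, charFun_conv, charFun_gaussianReal]
    have hexp : Continuous fun v : ℝ => charFun μ t * Complex.exp (-(v * t ^ 2 / 2)) := by
      fun_prop
    simp_rw [hchar]
    simpa [μ₀, Function.comp_def] using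
      (hexp.tendsto 0).comp tendsto_one_div_add_atTop_nhds_zero_nat
  have hfrontier : (μ₀ : Measure ℝ) (frontier (Set.Iic x)) = 0 := by simpa [μ₀] using hx
  exact (ENNReal.tendsto_toReal (measure_ne_top μ _)).comp
    (ProbabilityMeasure.tendsto_measure_of_null_frontier_of_tendsto' hlim hfrontier)

theorem exists_strictMono_tendsto_null_singleton (x : ℝ) :
    ∃ u : ℕ → ℝ, StrictMono u ∧ Tendsto u atTop (𝓝 x) ∧ (∀ n, u n < x) ∧
      ∀ n, μ {u n} = 0 ∧ ν {u n} = 0 := by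
  have hcount (κ : Measure ℝ) [IsProbabilityMeasure κ] : {y : ℝ | 0 < κ {y}}.Countable :=
    Measure.countable_meas_pos_of_disjoint_iUnion (fun y => measurableSet_singleton y)
      fun y z hyz => Set.disjoint_singleton.2 hyz
  obtain ⟨u, hu, hmem, hlim⟩ :=
    (((hcount μ).union (hcount ν)).dense_compl ℝ).exists_seq_strictMono_tendsto x
  exact ⟨u, hu, hlim, fun n => (hmem n).1, fun n => by simpa using (hmem n).2⟩

theorem tendsto_measureReal_Iic_of_tendsto {u : ℕ → ℝ} {x : ℝ} (hu : Monotone u)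
    (hux : ∀ n, u n < x) (hlim : Tendsto u atTop (𝓝 x)) :
    Tendsto (fun n => μ.real (Set.Iic (u n))) atTop (𝓝 (μ.real (Set.Iio x))) := by
  rw [← iUnion_Iic_eq_Iio_of_lt_of_tendsto hux hlim]
  exact (ENNReal.tendsto_toReal (measure_ne_top μ _)).comp
    (tendsto_measure_iUnion_atTop fun i j hij => Set.Iic_subset_Iic.2 (hu hij))

theorem abs_measureReal_Iio_sub_le_integral_norm_charFun_sub
    (hint : Integrable fun t : ℝ => (charFun μ t - charFun ν t) / t) (x : ℝ) :
    |μ.real (Set.Iio x) - ν.real (Set.Iio x)| ≤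
      (∫ t : ℝ, ‖(charFun μ t - charFun ν t) / t‖) / Real.pi := by
  obtain ⟨u, hu, hlim, hux, hnull⟩ :=
    exists_strictMono_tendsto_null_singleton (μ := μ) (ν := ν) x
  have hIio (κ : Measure ℝ) [IsProbabilityMeasure κ] :=
    tendsto_measureReal_Iic_of_tendsto (μ := κ) hu.monotone hux hlim
  refine le_of_tendsto' ((hIio μ).sub (hIio ν)).abs fun k => ?_
  exact le_of_tendsto' ((tendsto_measureReal_conv_gaussianReal_Iic (hnull k).1).sub
    (tendsto_measureReal_conv_gaussianReal_Iic (hnull k).2)).abs fun n =>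
      abs_measureReal_conv_gaussianReal_Iic_sub_le μ ν hint (by positivity) (u k)

end TwoLaws

end Smoothing

/-! ### Characteristic functions away from the origin -/

section AwayFromZero

theorem abs_sin_natCast_mul_le (k : ℕ) (x : ℝ) : |Real.sin (k * x)| ≤ k * |Real.sin x| := by
  induction k with
  | zero => simp
  | succ k ih =>
    calc |Real.sin ((k + 1 : ℕ) * x)|
        = |Real.sin (k * x) * Real.cos x + Real.cos (k * x) * Real.sin x| := by
          rw [Nat.cast_succ, add_one_mul, Real.sin_add]
      _ ≤ |Real.sin (k * x)| * |Real.cos x| + |Real.cos (k * x)| * |Real.sin x| := by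
          rw [← abs_mul, ← abs_mul]
          exact abs_add_le _ _
      _ ≤ k * |Real.sin x| * 1 + 1 * |Real.sin x| := by
          gcongr <;> exact Real.abs_cos_le_one _
      _ = (k + 1 : ℕ) * |Real.sin x| := by push_cast; ring

theorem one_sub_cos_eq (x : ℝ) : 1 - Real.cos x = 2 * Real.sin (x / 2) ^ 2 := by
  rw [Real.sin_sq_eq_half_sub, mul_div_cancel₀ x two_ne_zero]
  ring

theorem one_sub_cos_natCast_mul_add_le (k : ℕ) (x y : ℝ) :
    1 - Real.cos (k * x + y) ≤ 2 * (k : ℝ) ^ 2 * (1 - Real.cos x) + 2 * (1 - Real.cos y) := by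
  have hsin : |Real.sin (k * (x / 2) + y / 2)| ≤ k * |Real.sin (x / 2)| + |Real.sin (y / 2)| :=
    calc |Real.sin (k * (x / 2) + y / 2)|
        ≤ |Real.sin (k * (x / 2))| * |Real.cos (y / 2)|
            + |Real.cos (k * (x / 2))| * |Real.sin (y / 2)| := by
          rw [Real.sin_add, ← abs_mul, ← abs_mul]
          exact abs_add_le _ _
      _ ≤ k * |Real.sin (x / 2)| * 1 + 1 * |Real.sin (y / 2)| := by
          gcongr
          exacts [abs_sin_natCast_mul_le k _, Real.abs_cos_le_one _, Real.abs_cos_le_one _]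
      _ = k * |Real.sin (x / 2)| + |Real.sin (y / 2)| := by ring
  rw [one_sub_cos_eq, one_sub_cos_eq x, one_sub_cos_eq y,
    show (k * x + y) / 2 = k * (x / 2) + y / 2 by ring]
  calc 2 * Real.sin (k * (x / 2) + y / 2) ^ 2
      ≤ 2 * (k * |Real.sin (x / 2)| + |Real.sin (y / 2)|) ^ 2 := by
        rw [← sq_abs (Real.sin _)]
        gcongr
    _ ≤ 2 * (2 * ((k * |Real.sin (x / 2)|) ^ 2 + |Real.sin (y / 2)| ^ 2)) := by
        gcongr
        exact add_sq_le
    _ = 2 * (k : ℝ) ^ 2 * (2 * Real.sin (x / 2) ^ 2) + 2 * (2 * Real.sin (y / 2) ^ 2) := by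
        simp only [mul_pow, sq_abs]
        ring

section Symmetrization

variable (μ : Measure ℝ) [IsProbabilityMeasure μ]

theorem integrable_cos_mul_sub (t : ℝ) :
    Integrable (fun p : ℝ × ℝ => Real.cos (t * (p.1 - p.2))) (μ.prod μ) :=
  Integrable.of_bound (C := 1) (by fun_prop) (.of_forall fun _ => Real.abs_cos_le_one _)

theorem norm_charFun_sq (t : ℝ) :
    ‖charFun μ t‖ ^ 2 = ∫ p : ℝ × ℝ, Real.cos (t * (p.1 - p.2)) ∂(μ.prod μ) := by
  have hprod : charFun μ t * charFun μ (-t) =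
      ∫ p : ℝ × ℝ, Complex.exp (((t * (p.1 - p.2) : ℝ) : ℂ) * Complex.I) ∂(μ.prod μ) := by
    rw [charFun_apply_real, charFun_apply_real, ← integral_prod_mul]
    congr 1 with p
    rw [← Complex.exp_add]
    push_cast
    ring_nf
  have hint : Integrable (fun p : ℝ × ℝ =>
      Complex.exp (((t * (p.1 - p.2) : ℝ) : ℂ) * Complex.I)) (μ.prod μ) :=
    Integrable.of_bound (C := 1) (by fun_prop)
      (.of_forall fun p => (Complex.norm_exp_ofReal_mul_I _).le)
  calc ‖charFun μ t‖ ^ 2 = (charFun μ t * charFun μ (-t)).re := by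
        rw [charFun_neg, Complex.mul_conj', ← Complex.ofReal_pow, Complex.ofReal_re]
    _ = ∫ p : ℝ × ℝ, Real.cos (t * (p.1 - p.2)) ∂(μ.prod μ) := by
        rw [hprod, ← Complex.reCLM_apply, ← ContinuousLinearMap.integral_comp_comm _ hint]
        simp only [Complex.reCLM_apply, Complex.exp_ofReal_mul_I_re]

theorem one_sub_norm_charFun_sq (t : ℝ) :
    1 - ‖charFun μ t‖ ^ 2 = ∫ p : ℝ × ℝ, (1 - Real.cos (t * (p.1 - p.2))) ∂(μ.prod μ) := by
  rw [integral_sub (integrable_const _) (integrable_cos_mul_sub μ t), norm_charFun_sq]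
  simp

variable {μ}

theorem integral_norm_charFun_pos (hint : Integrable (charFun μ)) : 0 < ∫ t, ‖charFun μ t‖ :=
  integral_pos_of_integrable_nonneg_nonzero (x := 0) continuous_charFun.norm hint.norm
    (fun _ => norm_nonneg _) (by simp)

theorem one_sub_norm_charFun_sq_nonneg (t : ℝ) : 0 ≤ 1 - ‖charFun μ t‖ ^ 2 :=
  sub_nonneg.2 (pow_le_one₀ (norm_nonneg _) (norm_charFun_le_one t))

theorem integral_sub_sq_prod (hL2 : MemLp id 2 μ) :
    ∫ p : ℝ × ℝ, (p.1 - p.2) ^ 2 ∂(μ.prod μ) = 2 * Var[id; μ] := by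
  have hid : Integrable (fun x : ℝ => x) μ := hL2.integrable one_le_two
  have hmean : ∫ p : ℝ × ℝ, (p.1 + -p.2) ∂(μ.prod μ) = 0 := by
    rw [integral_add (hid.comp_fst μ) (hid.fun_neg.comp_snd μ), integral_fun_fst (fun x : ℝ => x),
      integral_fun_snd (fun x : ℝ => -x), integral_neg]
    simp
  have hvar := variance_add_prod hL2 hL2.neg
  simp only [Pi.neg_apply, id] at hvar
  rw [variance_of_integral_eq_zero (by fun_prop) hmean, variance_neg, ← two_mul] at hvar
  simpa only [sub_eq_add_neg] using hvar

theorem one_sub_norm_charFun_sq_le (hL2 : MemLp id 2 μ) (k : ℕ) (t s : ℝ) :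
    1 - ‖charFun μ (k * t + s)‖ ^ 2 ≤
      2 * (k : ℝ) ^ 2 * (1 - ‖charFun μ t‖ ^ 2) + 2 * Var[id; μ] * s ^ 2 := by
  have hcos (t : ℝ) : Integrable (fun p : ℝ × ℝ => 1 - Real.cos (t * (p.1 - p.2))) (μ.prod μ) :=
    (integrable_const _).sub (integrable_cos_mul_sub μ t)
  have hsq : Integrable (fun p : ℝ × ℝ => (p.1 - p.2) ^ 2) (μ.prod μ) :=
    ((hL2.comp_fst μ).sub (hL2.comp_snd μ)).integrable_sq
  rw [one_sub_norm_charFun_sq, one_sub_norm_charFun_sq, ← integral_sub_sq_prod hL2,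
    ← integral_const_mul, ← integral_mul_const,
    ← integral_add ((hcos t).const_mul _) (hsq.mul_const _)]
  refine integral_mono (hcos _) (((hcos t).const_mul _).add (hsq.mul_const _)) fun p => ?_
  have hsub := one_sub_cos_natCast_mul_add_le k (t * (p.1 - p.2)) (s * (p.1 - p.2))
  have hquad := Real.one_sub_sq_div_two_le_cos (x := s * (p.1 - p.2))
  simp only [show (k * t + s) * (p.1 - p.2) = k * (t * (p.1 - p.2)) + s * (p.1 - p.2) by ring]
  linarith

variable {σ t : ℝ}

theorem three_fifths_le_norm_charFun (hL2 : MemLp id 2 μ) (hσ : 0 < σ) (hvar : Var[id; μ] ≤ σ ^ 2)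
    {k : ℕ} (hk : (k : ℝ) ^ 2 * (1 - ‖charFun μ t‖ ^ 2) ≤ 4 / 25) {s : ℝ}
    (hs : |s - k * t| ≤ 2 / (5 * σ)) : 3 / 5 ≤ ‖charFun μ s‖ := by
  have hdist : Var[id; μ] * (s - k * t) ^ 2 ≤ 4 / 25 :=
    calc Var[id; μ] * (s - k * t) ^ 2 ≤ σ ^ 2 * (2 / (5 * σ)) ^ 2 := by
          rw [← sq_abs (s - k * t)]
          gcongr
      _ = 4 / 25 := by field_simp; norm_num
  have h := one_sub_norm_charFun_sq_le hL2 k t (s - k * t)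
  rw [add_sub_cancel] at h
  refine le_of_sq_le_sq ?_ (norm_nonneg _)
  linarith

end Symmetrization

theorem mul_le_integral_of_le_near_multiples {f : ℝ → ℝ} (hf : Integrable f) (hf0 : 0 ≤ f)
    {c t w : ℝ} (hw : 0 ≤ w) (hwt : 2 * w < t) {N : ℕ}
    (hc : ∀ k < N, ∀ s, |s - k * t| ≤ w → c ≤ f s) : N * (2 * w * c) ≤ ∫ s, f s := by
  set J : ℕ → Set ℝ := fun k => Set.Icc (k * t - w) (k * t + w) with hJ
  have hdisj : Pairwise (Function.onFun Disjoint J) := by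
    refine (pairwise_disjoint_on J).2 fun i j hij => ?_
    have hij' : (i : ℝ) + 1 ≤ j := by exact_mod_cast hij
    refine Set.disjoint_left.2 fun s hi hj => ?_
    nlinarith [hi.2, hj.1]
  have hlower : ∀ k ∈ Finset.range N, 2 * w * c ≤ ∫ s in J k, f s := fun k hk =>
    calc 2 * w * c = ∫ _ in J k, c := by
          rw [setIntegral_const, hJ, Real.volume_real_Icc_of_le (by linarith), smul_eq_mul]
          ring
      _ ≤ ∫ s in J k, f s :=
          setIntegral_mono_on (integrableOn_const (by simp [hJ])) hf.integrableOn
            measurableSet_Icc fun s hs => hc k (Finset.mem_range.1 hk) s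
              (abs_le.2 ⟨by linarith [hs.1], by linarith [hs.2]⟩)
  calc N * (2 * w * c) = ∑ k ∈ Finset.range N, 2 * w * c := by simp
    _ ≤ ∑ k ∈ Finset.range N, ∫ s in J k, f s := Finset.sum_le_sum hlower
    _ = ∫ s in ⋃ k ∈ Finset.range N, J k, f s :=
        (integral_biUnion_finset _ (fun k _ => measurableSet_Icc) (hdisj.set_pairwise _)
          fun k _ => hf.integrableOn).symm
    _ ≤ ∫ s, f s := setIntegral_le_integral hf (.of_forall hf0)

variable {μ : Measure ℝ} [IsProbabilityMeasure μ] {σ t : ℝ}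

theorem mul_le_integral_norm_charFun (hint : Integrable (charFun μ)) (hL2 : MemLp id 2 μ)
    (hσ : 0 < σ) (hvar : Var[id; μ] ≤ σ ^ 2) (ht : 1 ≤ σ * t) {K : ℕ}
    (hK : (K : ℝ) ^ 2 * (1 - ‖charFun μ t‖ ^ 2) ≤ 4 / 25) :
    12 / 25 * ((K : ℝ) + 1) ≤ σ * ∫ s, ‖charFun μ s‖ := by
  have hwt : 2 * (2 / (5 * σ)) < t := by
    rw [← mul_div_assoc, div_lt_iff₀ (by positivity)]
    linarith
  have h := mul_le_integral_of_le_near_multiples hint.norm (fun s => norm_nonneg _)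
    (c := 3 / 5) (by positivity) hwt (N := K + 1) fun k hk s hs =>
      three_fifths_le_norm_charFun hL2 hσ hvar (hK.trans' (by
        have hkK : k ≤ K := Nat.lt_succ_iff.1 hk
        have := one_sub_norm_charFun_sq_nonneg (μ := μ) t
        gcongr)) hs
  calc 12 / 25 * ((K : ℝ) + 1) = σ * ((K + 1 : ℕ) * (2 * (2 / (5 * σ)) * (3 / 5))) := by
        push_cast
        field_simp
        norm_num
    _ ≤ σ * ∫ s, ‖charFun μ s‖ := by gcongr

theorem lt_sq_mul_one_sub_norm_charFun_sq (hint : Integrable (charFun μ)) (hL2 : MemLp id 2 μ)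
    (hσ : 0 < σ) (hvar : Var[id; μ] ≤ σ ^ 2) (ht : 1 ≤ σ * t) :
    4 / 25 < (25 / 12 * (σ * ∫ s, ‖charFun μ s‖)) ^ 2 * (1 - ‖charFun μ t‖ ^ 2) := by
  set B := σ * ∫ s, ‖charFun μ s‖
  have : 0 ≤ B := by positivity
  by_contra! hle
  have hfloor : (⌊25 / 12 * B⌋₊ : ℝ) ≤ 25 / 12 * B := Nat.floor_le (by positivity)
  have h := mul_le_integral_norm_charFun hint hL2 hσ hvar ht (hle.trans' (by
    have := one_sub_norm_charFun_sq_nonneg (μ := μ) t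
    gcongr))
  linarith [Nat.lt_floor_add_one (25 / 12 * B)]

theorem norm_charFun_le_bConst (hint : Integrable (charFun μ)) (hL2 : MemLp id 2 μ)
    (hσ : 0 < σ) (hvar : Var[id; μ] ≤ σ ^ 2) (ht : 1 ≤ σ * |t|) :
    ‖charFun μ t‖ ≤ Pseudomoments.bConst (Pseudomoments.charFunL1 μ) σ := by
  wlog hpos : 0 ≤ t generalizing t
  · simpa [charFun_neg] using this (t := -t) (by rwa [abs_neg]) (by linarith)
  rw [abs_of_nonneg hpos] at ht
  have hgap := lt_sq_mul_one_sub_norm_charFun_sq hint hL2 hσ hvar ht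
  rw [Pseudomoments.bConst, Pseudomoments.charFunL1]
  set A := ∫ s, ‖charFun μ s‖
  set δ := 1 - ‖charFun μ t‖ ^ 2
  have hA : 0 < A := integral_norm_charFun_pos hint
  have hpi : Real.pi ^ 2 ≤ (33 / 50 * (2 + Real.pi)) ^ 2 :=
    pow_le_pow_left₀ Real.pi_pos.le (by linarith [Real.pi_lt_d2]) 2
  have hexponent : Real.pi ^ 2 / (24 * A ^ 2 * σ ^ 2 * (2 + Real.pi) ^ 2) ≤ δ / 2 := by
    rw [div_le_iff₀ (by positivity)]
    nlinarith [mul_le_mul_of_nonneg_right hgap.le (sq_nonneg (2 + Real.pi))]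
  have hsq : ‖charFun μ t‖ ^ 2 ≤ Real.exp (-(δ / 2)) ^ 2 := by
    rw [← Real.exp_nat_mul, show ((2 : ℕ) : ℝ) * -(δ / 2) = -δ by push_cast; ring]
    linarith [Real.add_one_le_exp (-δ)]
  calc ‖charFun μ t‖ ≤ Real.exp (-(δ / 2)) := le_of_sq_le_sq hsq (Real.exp_nonneg _)
    _ ≤ _ := Real.exp_le_exp.2 (neg_le_neg hexponent)

end AwayFromZero

/-! ### Elementary estimates -/

section Elementary

open Filter Topology

theorem pow_div_factorial_anti {t : ℝ} (ht : 0 ≤ t) {j k : ℕ} (hj : t ≤ j) (hjk : j ≤ k) :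
    t ^ k / k.factorial ≤ t ^ j / j.factorial := by
  induction k, hjk using Nat.le_induction with
  | base => exact le_rfl
  | succ k hk ih =>
    have htk : t ≤ (k + 1 : ℕ) := hj.trans (by exact_mod_cast hk.trans k.le_succ)
    calc t ^ (k + 1) / (k + 1).factorial = t ^ k / k.factorial * (t / (k + 1 : ℕ)) := by
          rw [Nat.factorial_succ]
          push_cast
          field_simp
          rw [pow_succ]
      _ ≤ t ^ k / k.factorial * 1 := by
          gcongr
          exact div_le_one_of_le₀ htk (by positivity)
      _ ≤ t ^ j / j.factorial := by rwa [mul_one]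

theorem pow_div_factorial_add_succ_le_exp_sub_one {t : ℝ} (ht : 0 ≤ t) {k : ℕ} (hk : 1 ≤ k) :
    t ^ k / k.factorial + t ^ (k + 1) / (k + 1).factorial ≤ Real.exp t - 1 := by
  have hexp := Real.sum_le_exp_of_nonneg ht (k + 2)
  have hone : t ^ 0 / (Nat.factorial 0) ≤ ∑ i ∈ Finset.range k, t ^ i / i.factorial :=
    Finset.single_le_sum (f := fun i => t ^ i / (i.factorial : ℝ)) (fun i _ => by positivity)
      (Finset.mem_range.2 hk)
  rw [Finset.sum_range_succ, Finset.sum_range_succ] at hexp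
  norm_num at hone
  linarith

theorem pow_div_factorial_add_le {m : ℕ} (hm : 3 ≤ m) {t : ℝ} (ht : 0 ≤ t) :
    t ^ (m + 1) / (m + 1).factorial + 2 * (t ^ m / m.factorial) ≤
      2 * (Real.exp (t ^ 2 / 3) - 1) := by
  rcases le_total t 3 with h | h
  · have h3 := pow_div_factorial_anti ht (j := 3) (by exact_mod_cast h) hm
    have h4 := pow_div_factorial_anti ht (j := 4) (k := m + 1) (by push_cast; linarith) (by lia)
    have hexp := Real.quadratic_le_exp_of_nonneg (x := t ^ 2 / 3) (by positivity)
    rw [show ((Nat.factorial 3 : ℕ) : ℝ) = 6 by norm_num [Nat.factorial]] at h3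
    rw [show ((Nat.factorial 4 : ℕ) : ℝ) = 24 by norm_num [Nat.factorial]] at h4
    have hquad : 0 ≤ t ^ 2 * (2 / 3 - t / 3 + 5 * t ^ 2 / 72) :=
      mul_nonneg (sq_nonneg t) (by nlinarith [sq_nonneg (t - 12 / 5)])
    linarith
  · have hsucc := pow_div_factorial_add_succ_le_exp_sub_one ht (k := m) (by lia)
    have hpos : 0 ≤ t ^ (m + 1) / (m + 1).factorial := by positivity
    have hexp : Real.exp t ≤ Real.exp (t ^ 2 / 3) := Real.exp_le_exp.2 (by nlinarith)
    linarith

theorem norm_pow_sub_pow_le {z w : ℂ} {M : ℝ} (hz : ‖z‖ ≤ M) (hw : ‖w‖ ≤ M) (n : ℕ) :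
    ‖z ^ n - w ^ n‖ ≤ n * ‖z - w‖ * M ^ (n - 1) := by
  have hM : 0 ≤ M := (norm_nonneg _).trans hz
  have hsum : ‖∑ i ∈ Finset.range n, z ^ i * w ^ (n - 1 - i)‖ ≤ n * M ^ (n - 1) :=
    calc ‖∑ i ∈ Finset.range n, z ^ i * w ^ (n - 1 - i)‖
        ≤ ∑ _i ∈ Finset.range n, M ^ (n - 1) := by
          refine norm_sum_le_of_le _ fun i hi => ?_
          have hi' : i + (n - 1 - i) = n - 1 := by grind
          rw [norm_mul, norm_pow, norm_pow, ← congrArg (M ^ ·) hi', pow_add]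
          gcongr
      _ = n * M ^ (n - 1) := by simp
  calc ‖z ^ n - w ^ n‖ = ‖∑ i ∈ Finset.range n, z ^ i * w ^ (n - 1 - i)‖ * ‖z - w‖ := by
        rw [← norm_mul, Commute.geom_sum₂_mul (Commute.all z w)]
    _ ≤ n * M ^ (n - 1) * ‖z - w‖ := by gcongr
    _ = n * ‖z - w‖ * M ^ (n - 1) := by ring

theorem integral_abs_pow_mul_exp_neg_mul_sq (j : ℕ) {a : ℝ} (ha : 0 < a) :
    ∫ s : ℝ, |s| ^ j * Real.exp (-(a * s ^ 2)) =
      a ^ (-((j : ℝ) + 1) / 2) * Real.Gamma (((j : ℝ) + 1) / 2) := by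
  have hhalf := integral_rpow_mul_exp_neg_mul_rpow (p := 2) (q := j) two_pos
    ((by norm_num : (-1 : ℝ) < 0).trans_le j.cast_nonneg) ha
  have habs := integral_comp_abs (f := fun s : ℝ => s ^ j * Real.exp (-(a * s ^ 2)))
  simp only [sq_abs] at habs
  simp only [Real.rpow_natCast, Real.rpow_ofNat, neg_mul] at hhalf
  rw [habs, hhalf]
  ring

theorem integrable_abs_pow_mul_exp_neg_mul_sq (j : ℕ) {a : ℝ} (ha : 0 < a) :
    Integrable fun s : ℝ => |s| ^ j * Real.exp (-(a * s ^ 2)) := by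
  refine Integrable.of_integral_ne_zero ?_
  rw [integral_abs_pow_mul_exp_neg_mul_sq j ha]
  have := Real.Gamma_pos_of_pos (s := ((j : ℝ) + 1) / 2) (by positivity)
  positivity

theorem integral_Ioi_mul_exp_neg_mul_sq {a T : ℝ} (ha : 0 < a) (hT : 0 ≤ T) :
    ∫ s in Set.Ioi T, s * Real.exp (-(a * s ^ 2)) = Real.exp (-(a * T ^ 2)) / (2 * a) := by
  have hderiv (x : ℝ) : HasDerivAt (fun u : ℝ => -(Real.exp (-(a * u ^ 2)) / (2 * a)))
      (x * Real.exp (-(a * x ^ 2))) x := by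
    refine (((hasDerivAt_pow 2 x).const_mul a).fun_neg.exp.div_const (2 * a)).fun_neg.congr_deriv ?_
    push_cast
    field_simp
  have hlim : Tendsto (fun u : ℝ => -(Real.exp (-(a * u ^ 2)) / (2 * a))) atTop (𝓝 0) := by
    have hsq : Tendsto (fun u : ℝ => a * u ^ 2) atTop atTop :=
      (tendsto_pow_atTop two_ne_zero).const_mul_atTop ha
    simpa using ((Real.tendsto_exp_neg_atTop_nhds_zero.comp hsq).div_const (2 * a)).neg
  rw [integral_Ioi_of_hasDerivAt_of_nonneg' (fun x _ => hderiv x) (fun x hx => ?_) hlim]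
  · ring
  · have : 0 ≤ x := hT.trans (le_of_lt hx)
    positivity

theorem setIntegral_abs_mul_exp_neg_mul_sq {a T : ℝ} (ha : 0 < a) (hT : 0 ≤ T) :
    ∫ s in {s : ℝ | T < |s|}, |s| * Real.exp (-(a * s ^ 2)) = Real.exp (-(a * T ^ 2)) / a := by
  have habs := integral_comp_abs
    (f := (Set.Ioi T).indicator fun u => u * Real.exp (-(a * u ^ 2)))
  rw [setIntegral_indicator measurableSet_Ioi, Set.Ioi_inter_Ioi, max_eq_right hT,
    integral_Ioi_mul_exp_neg_mul_sq ha hT] at habs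
  have hmeas : MeasurableSet {s : ℝ | T < |s|} := measurableSet_lt (by fun_prop) (by fun_prop)
  rw [← integral_indicator hmeas]
  calc _ = ∫ s : ℝ, (Set.Ioi T).indicator (fun u => u * Real.exp (-(a * u ^ 2))) |s| := by
        congr 1 with s
        simp [Set.indicator]
    _ = _ := by rw [habs]; field_simp

end Elementary

/-! ### Comparison with the Gaussian characteristic function -/

section Comparison

theorem norm_charFun_gaussianReal_zero_one (t : ℝ) :
    ‖charFun (gaussianReal 0 1) t‖ = Real.exp (-(t ^ 2 / 2)) := by
  rw [charFun_gaussianReal, Complex.norm_exp]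
  congr 1
  simp [← Complex.ofReal_pow]

theorem charFun_gaussianReal_zero_one_div_sqrt_pow {n : ℕ} (hn : n ≠ 0) (t : ℝ) :
    charFun (gaussianReal 0 1) (t / √n) ^ n = charFun (gaussianReal 0 1) t := by
  have hsq : ((√n : ℝ) : ℂ) ^ 2 = n := by
    rw [← Complex.ofReal_pow, Real.sq_sqrt n.cast_nonneg, Complex.ofReal_natCast]
  have hn' : (n : ℂ) ≠ 0 := Nat.cast_ne_zero.2 hn
  rw [charFun_gaussianReal, charFun_gaussianReal, ← Complex.exp_nat_mul]
  congr 1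
  push_cast
  rw [div_pow, hsq]
  simp
  field_simp

variable {m n : ℕ} {a₁ a₂ ρ s : ℝ} {z w : ℂ}

theorem pseudomomentBound_nonneg (ha₁ : 0 ≤ a₁) (ha₂ : 0 ≤ a₂) (t : ℝ) :
    0 ≤ pseudomomentBound m a₁ a₂ t := by
  unfold pseudomomentBound
  positivity

theorem pseudomomentBound_le (hm : 3 ≤ m) (hρ : 0 ≤ ρ) (ha₁ : a₁ ≤ ρ) (ha₂ : a₂ ≤ ρ) (t : ℝ) :
    pseudomomentBound m a₁ a₂ t ≤ 2 * ρ * (Real.exp (t ^ 2 / 3) - 1) :=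
  calc pseudomomentBound m a₁ a₂ t
      ≤ ρ * (|t| ^ (m + 1) / (m + 1).factorial) + ρ * (2 * (|t| ^ m / m.factorial)) := by
        unfold pseudomomentBound
        gcongr
    _ = ρ * (|t| ^ (m + 1) / (m + 1).factorial + 2 * (|t| ^ m / m.factorial)) := by ring
    _ ≤ ρ * (2 * (Real.exp (|t| ^ 2 / 3) - 1)) := by
        gcongr
        exact pow_div_factorial_add_le hm (abs_nonneg t)
    _ = 2 * ρ * (Real.exp (t ^ 2 / 3) - 1) := by rw [sq_abs]; ring

theorem norm_le_exp_neg_sq_div_six (hw : ‖w‖ ≤ Real.exp (-(s ^ 2 / 2)))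
    (hclose : ‖z - w‖ ≤ 2 * ρ * (Real.exp (s ^ 2 / 3) - 1))
    (hρ : 2 * ρ ≤ Real.exp (-(s ^ 2 / 2))) : ‖z‖ ≤ Real.exp (-(s ^ 2 / 6)) :=
  have hexp : 0 ≤ Real.exp (s ^ 2 / 3) - 1 := sub_nonneg.2 (Real.one_le_exp (by positivity))
  calc ‖z‖ ≤ ‖w‖ + ‖z - w‖ := norm_le_norm_add_norm_sub' z w
    _ ≤ Real.exp (-(s ^ 2 / 2)) + Real.exp (-(s ^ 2 / 2)) * (Real.exp (s ^ 2 / 3) - 1) := by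
        gcongr
        exact hclose.trans (by gcongr)
    _ = Real.exp (-(s ^ 2 / 2) + s ^ 2 / 3) := by rw [Real.exp_add]; ring
    _ = Real.exp (-(s ^ 2 / 6)) := by ring_nf

theorem norm_pow_sub_pow_le_of_le_exp (hn : 2 ≤ n) (hz : ‖z‖ ≤ Real.exp (-(s ^ 2 / 6)))
    (hw : ‖w‖ ≤ Real.exp (-(s ^ 2 / 6))) :
    ‖z ^ n - w ^ n‖ ≤ n * ‖z - w‖ * Real.exp (-(n / 12 * s ^ 2)) := by
  have hn' : (2 : ℝ) ≤ n := by exact_mod_cast hn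
  have hexp : Real.exp (-(s ^ 2 / 6)) ^ (n - 1) ≤ Real.exp (-(n / 12 * s ^ 2)) := by
    rw [← Real.exp_nat_mul, Nat.cast_pred (by lia)]
    exact Real.exp_le_exp.2 (by nlinarith [sq_nonneg s])
  exact (norm_pow_sub_pow_le hz hw n).trans (by gcongr)

theorem norm_pow_sub_pow_le_of_exp_le {b : ℝ} (hn : 1 ≤ n) (hz : ‖z‖ ≤ b)
    (hw : ‖w‖ ≤ Real.exp (-(s ^ 2 / 2))) (hρ : Real.exp (-(s ^ 2 / 2)) ≤ 2 * ρ) :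
    ‖z ^ n - w ^ n‖ ≤ b ^ (n - 1) * ‖z‖ + 2 * ρ * Real.exp (-((n - 1) / 2 * s ^ 2)) := by
  obtain ⟨k, rfl⟩ := Nat.exists_eq_add_of_le' hn
  have hexp : Real.exp (-(s ^ 2 / 2)) ^ k = Real.exp (-(((k + 1 : ℕ) - 1) / 2 * s ^ 2)) := by
    rw [← Real.exp_nat_mul]
    push_cast
    ring_nf
  calc ‖z ^ (k + 1) - w ^ (k + 1)‖ ≤ ‖z‖ ^ k * ‖z‖ + ‖w‖ * ‖w‖ ^ k := by
        simpa only [norm_pow, pow_succ, pow_succ', norm_mul, mul_comm] using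
          norm_sub_le (z ^ (k + 1)) (w ^ (k + 1))
    _ ≤ b ^ k * ‖z‖ + 2 * ρ * Real.exp (-(s ^ 2 / 2)) ^ k := by
        have hρ0 : 0 ≤ 2 * ρ := (Real.exp_nonneg _).trans hρ
        gcongr
        exact hw.trans hρ
    _ = _ := by rw [hexp, Nat.add_sub_cancel]

/-- A majorant of `‖(f s ^ n - exp (-s² / 2) ^ n) / s‖`, integrable in `s`, when `f` is within
`pseudomomentBound m a₁ a₂ s` of `exp (-s² / 2)` and `‖f s‖ ≤ b` for `1 ≤ |s|`. The first summand
covers the points where `2 * ρ ≤ exp (-s² / 2)`, the other two cover the remaining ones. -/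
noncomputable def quotientMajorant (f : ℝ → ℂ) (m n : ℕ) (a₁ a₂ b ρ s : ℝ) : ℝ :=
  n * (pseudomomentBound m a₁ a₂ s / |s|) * Real.exp (-(n / 12 * s ^ 2))
    + b ^ (n - 1) * ‖f s‖
    + 2 * ρ * {u : ℝ | 1 < |u|}.indicator (fun u => |u| * Real.exp (-((n - 1) / 2 * u ^ 2))) s

theorem norm_pow_sub_charFun_pow_div_le_of_le_exp (hm : 3 ≤ m) (hn : 2 ≤ n)
    (hclose : ‖z - charFun (gaussianReal 0 1) s‖ ≤ pseudomomentBound m a₁ a₂ s)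
    (hρ0 : 0 ≤ ρ) (ha₁ : a₁ ≤ ρ) (ha₂ : a₂ ≤ ρ) (hs : 2 * ρ ≤ Real.exp (-(s ^ 2 / 2))) :
    ‖(z ^ n - charFun (gaussianReal 0 1) s ^ n) / s‖ ≤
      n * (pseudomomentBound m a₁ a₂ s / |s|) * Real.exp (-(n / 12 * s ^ 2)) := by
  have hgauss := (norm_charFun_gaussianReal_zero_one s).le
  have hz := norm_le_exp_neg_sq_div_six hgauss
    (hclose.trans (pseudomomentBound_le hm hρ0 ha₁ ha₂ s)) hs
  have hg := hgauss.trans (Real.exp_le_exp.2 (by linarith [sq_nonneg s] :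
    -(s ^ 2 / 2) ≤ -(s ^ 2 / 6)))
  calc ‖(z ^ n - charFun (gaussianReal 0 1) s ^ n) / s‖
      ≤ n * pseudomomentBound m a₁ a₂ s * Real.exp (-(n / 12 * s ^ 2)) / |s| := by
        rw [norm_div, Complex.norm_real, Real.norm_eq_abs]
        gcongr
        exact (norm_pow_sub_pow_le_of_le_exp hn hz hg).trans (by gcongr)
    _ = n * (pseudomomentBound m a₁ a₂ s / |s|) * Real.exp (-(n / 12 * s ^ 2)) := by ring

theorem norm_pow_sub_charFun_pow_div_le_of_exp_le {b : ℝ} (hn : 1 ≤ n) (hz : ‖z‖ ≤ b)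
    (hs : 1 ≤ |s|) (hρ : Real.exp (-(s ^ 2 / 2)) ≤ 2 * ρ) :
    ‖(z ^ n - charFun (gaussianReal 0 1) s ^ n) / s‖ ≤
      b ^ (n - 1) * ‖z‖ + 2 * ρ * (|s| * Real.exp (-((n - 1) / 2 * s ^ 2))) := by
  have hρ0 : 0 ≤ 2 * ρ := (Real.exp_nonneg _).trans hρ
  calc ‖(z ^ n - charFun (gaussianReal 0 1) s ^ n) / s‖
      ≤ ‖z ^ n - charFun (gaussianReal 0 1) s ^ n‖ := by
        rw [norm_div, Complex.norm_real, Real.norm_eq_abs]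
        exact div_le_self (norm_nonneg _) hs
    _ ≤ b ^ (n - 1) * ‖z‖ + 2 * ρ * Real.exp (-((n - 1) / 2 * s ^ 2)) :=
        norm_pow_sub_pow_le_of_exp_le hn hz (norm_charFun_gaussianReal_zero_one s).le hρ
    _ ≤ b ^ (n - 1) * ‖z‖ + 2 * ρ * (|s| * Real.exp (-((n - 1) / 2 * s ^ 2))) := by
        gcongr
        exact le_mul_of_one_le_left (Real.exp_nonneg _) hs

theorem norm_pow_sub_charFun_pow_div_le {f : ℝ → ℂ} {b : ℝ} (hm : 3 ≤ m) (hn : 2 ≤ n)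
    (hclose : ∀ s, ‖f s - charFun (gaussianReal 0 1) s‖ ≤ pseudomomentBound m a₁ a₂ s)
    (ha₁ : a₁ ∈ Set.Icc 0 ρ) (ha₂ : a₂ ∈ Set.Icc 0 ρ) (hρ : 2 * ρ ≤ Real.exp (-(1 / 2)))
    (hb : 0 ≤ b) (hfb : ∀ s, 1 ≤ |s| → ‖f s‖ ≤ b) (s : ℝ) :
    ‖(f s ^ n - charFun (gaussianReal 0 1) s ^ n) / s‖ ≤ quotientMajorant f m n a₁ a₂ b ρ s := by
  have hρ0 : 0 ≤ ρ := ha₁.1.trans ha₁.2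
  have hnear : 0 ≤ n * (pseudomomentBound m a₁ a₂ s / |s|) * Real.exp (-(n / 12 * s ^ 2)) := by
    have := pseudomomentBound_nonneg (m := m) ha₁.1 ha₂.1 s
    positivity
  have htail : 0 ≤ {u : ℝ | 1 < |u|}.indicator
      (fun u => |u| * Real.exp (-((n - 1) / 2 * u ^ 2))) s :=
    Set.indicator_nonneg (fun u _ => by positivity) s
  rw [quotientMajorant, add_assoc]
  rcases le_or_gt (2 * ρ) (Real.exp (-(s ^ 2 / 2))) with hs | hs
  · exact (norm_pow_sub_charFun_pow_div_le_of_le_exp hm hn (hclose s) hρ0 ha₁.2 ha₂.2 hs).trans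
      (le_add_of_nonneg_right (by positivity))
  · have hs1 : 1 < |s| := by
      have := Real.exp_lt_exp.1 (hs.trans_le hρ)
      exact (one_lt_sq_iff_one_lt_abs s).1 (by linarith)
    rw [Set.indicator_of_mem (show s ∈ {u : ℝ | 1 < |u|} from hs1)]
    exact (norm_pow_sub_charFun_pow_div_le_of_exp_le (by lia) (hfb s hs1.le) hs1.le hs.le).trans
      (le_add_of_nonneg_left hnear)

theorem div_factorial_mul_integral_abs_pow_eq_C1 {c : ℝ} (hc : 0 < c) (j : ℕ) :
    c / (j + 1).factorial * ∫ s : ℝ, |s| ^ j * Real.exp (-(c / 12 * s ^ 2)) =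
      Real.pi * (Pseudomoments.C1 j / c ^ (((j : ℝ) - 1) / 2)) := by
  have hpow : c ^ (((j : ℝ) + 1) / 2) = c ^ (((j : ℝ) - 1) / 2) * c := by
    rw [← Real.rpow_add_one hc.ne']
    ring_nf
  have := Real.rpow_pos_of_pos hc (((j : ℝ) - 1) / 2)
  have := Real.pi_pos
  rw [integral_abs_pow_mul_exp_neg_mul_sq j (by positivity), neg_div, Real.rpow_neg (by positivity),
    Real.div_rpow hc.le (by norm_num), hpow, Pseudomoments.C1]
  field_simp

theorem mul_pseudomomentBound_div_abs_eq (hm : 2 ≤ m) (c s : ℝ) :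
    c * (pseudomomentBound m a₁ a₂ s / |s|) * Real.exp (-(c / 12 * s ^ 2)) =
      a₁ * (c / (m + 1).factorial * (|s| ^ m * Real.exp (-(c / 12 * s ^ 2))))
      + 2 * a₂ * (c / m.factorial * (|s| ^ (m - 1) * Real.exp (-(c / 12 * s ^ 2)))) := by
  obtain ⟨k, rfl⟩ := Nat.exists_eq_add_of_le' hm
  have hdiv (j : ℕ) : |s| ^ (j + 1) = |s| ^ (j + 2) / |s| := by
    rcases eq_or_ne s 0 with rfl | hs
    · simp
    · rw [pow_succ _ (j + 1), mul_div_cancel_right₀ _ (abs_ne_zero.2 hs)]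
  rw [pseudomomentBound, show k + 2 - 1 = k + 1 from rfl, hdiv k, hdiv (k + 1)]
  ring

theorem integrable_mul_pseudomomentBound_div_abs (hm : 2 ≤ m) {c : ℝ} (hc : 0 < c) :
    Integrable fun s : ℝ =>
      c * (pseudomomentBound m a₁ a₂ s / |s|) * Real.exp (-(c / 12 * s ^ 2)) := by
  simp only [mul_pseudomomentBound_div_abs_eq hm]
  exact (((integrable_abs_pow_mul_exp_neg_mul_sq m (by positivity)).const_mul _).const_mul _).add
    (((integrable_abs_pow_mul_exp_neg_mul_sq (m - 1) (by positivity)).const_mul _).const_mul _)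

theorem integral_mul_pseudomomentBound_div_abs (hm : 2 ≤ m) {c : ℝ} (hc : 0 < c) :
    ∫ s : ℝ, c * (pseudomomentBound m a₁ a₂ s / |s|) * Real.exp (-(c / 12 * s ^ 2)) =
      Real.pi * (Pseudomoments.C1 m * a₁ / c ^ (((m : ℝ) - 1) / 2)
        + Pseudomoments.C2 m * a₂ / c ^ (((m : ℝ) - 2) / 2)) := by
  have hgauss (j : ℕ) : Integrable fun s : ℝ => |s| ^ j * Real.exp (-(c / 12 * s ^ 2)) :=
    integrable_abs_pow_mul_exp_neg_mul_sq j (by positivity)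
  have hpred := div_factorial_mul_integral_abs_pow_eq_C1 hc (m - 1)
  rw [Nat.sub_add_cancel (by lia : 1 ≤ m), Nat.cast_pred (by lia),
    show ((m : ℝ) - 1 - 1) / 2 = ((m : ℝ) - 2) / 2 by ring] at hpred
  simp only [mul_pseudomomentBound_div_abs_eq hm]
  rw [integral_add (((hgauss m).const_mul _).const_mul _)
      (((hgauss (m - 1)).const_mul _).const_mul _), integral_const_mul, integral_const_mul,
    integral_const_mul, integral_const_mul, div_factorial_mul_integral_abs_pow_eq_C1 hc, hpred,
    Pseudomoments.C2]
  ring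

theorem integrable_indicator_abs_mul_exp_neg_mul_sq {a : ℝ} (ha : 0 < a) (T : ℝ) :
    Integrable ({s : ℝ | T < |s|}.indicator fun s => |s| * Real.exp (-(a * s ^ 2))) := by
  have hmeas : MeasurableSet {s : ℝ | T < |s|} := measurableSet_lt (by fun_prop) (by fun_prop)
  simpa only [pow_one] using (integrable_abs_pow_mul_exp_neg_mul_sq 1 ha).indicator hmeas

variable {f : ℝ → ℂ}

theorem integrable_quotientMajorant (hm : 2 ≤ m) (hn : 2 ≤ n) (hf : Integrable f) (b : ℝ) :
    Integrable (quotientMajorant f m n a₁ a₂ b ρ) := by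
  have hn' : (2 : ℝ) ≤ n := by exact_mod_cast hn
  exact ((integrable_mul_pseudomomentBound_div_abs hm (by linarith)).add
    (hf.norm.const_mul _)).add
      ((integrable_indicator_abs_mul_exp_neg_mul_sq (by linarith) 1).const_mul _)

theorem integral_quotientMajorant (hm : 2 ≤ m) (hn : 2 ≤ n) (hf : Integrable f) (b : ℝ) :
    ∫ s, quotientMajorant f m n a₁ a₂ b ρ s =
      Real.pi * (Pseudomoments.C1 m * a₁ / (n : ℝ) ^ (((m : ℝ) - 1) / 2)
        + Pseudomoments.C2 m * a₂ / (n : ℝ) ^ (((m : ℝ) - 2) / 2))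
      + b ^ (n - 1) * (∫ s, ‖f s‖)
      + 4 * ρ * (Real.exp (-(((n : ℝ) - 1) / 2)) / (n - 1)) := by
  have hn' : (2 : ℝ) ≤ n := by exact_mod_cast hn
  have hmeas : MeasurableSet {s : ℝ | 1 < |s|} := measurableSet_lt (by fun_prop) (by fun_prop)
  have hnear := integrable_mul_pseudomomentBound_div_abs (a₁ := a₁) (a₂ := a₂) hm
    (by linarith : 0 < (n : ℝ))
  have hfar := hf.norm.const_mul (b ^ (n - 1))
  have htail := integrable_indicator_abs_mul_exp_neg_mul_sq
    (by linarith : 0 < ((n : ℝ) - 1) / 2) 1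
  unfold quotientMajorant
  rw [integral_add (by exact hnear.add hfar) (htail.const_mul (2 * ρ)), integral_add hnear hfar,
    integral_const_mul, integral_const_mul, integral_indicator hmeas,
    setIntegral_abs_mul_exp_neg_mul_sq (by linarith) zero_le_one,
    integral_mul_pseudomomentBound_div_abs hm (by linarith)]
  have : (n : ℝ) - 1 ≠ 0 := by linarith
  field_simp
  ring

theorem charFun_sub_charFun_gaussianReal_div_eq {κ : Measure ℝ} (hn : n ≠ 0)
    (hκ : ∀ t, charFun κ t = f (t / √n) ^ n) (t : ℝ) :
    (charFun κ t - charFun (gaussianReal 0 1) t) / t =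
      (√n : ℂ)⁻¹ * ((f (t / √n) ^ n - charFun (gaussianReal 0 1) (t / √n) ^ n) / (t / √n : ℝ)) := by
  have hsqrt : ((√n : ℝ) : ℂ) ≠ 0 := by
    exact_mod_cast (Real.sqrt_pos.2 (by exact_mod_cast Nat.pos_of_ne_zero hn)).ne'
  rw [hκ, charFun_gaussianReal_zero_one_div_sqrt_pow hn]
  push_cast
  field_simp

theorem cdf_gaussianReal_eq_measureReal_Iio {v : NNReal} (hv : v ≠ 0) (μ x : ℝ) :
    cdf (gaussianReal μ v) x = (gaussianReal μ v).real (Set.Iio x) := by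
  have := nullSingletonClass_gaussianReal (μ := μ) hv
  rw [cdf_eq_real, measureReal_def, measureReal_def, measure_congr Iio_ae_eq_Iic]

theorem integrable_pow_sub_charFun_pow_div {b : ℝ} (hm : 3 ≤ m) (hn : 2 ≤ n) (hf : Integrable f)
    (hclose : ∀ s, ‖f s - charFun (gaussianReal 0 1) s‖ ≤ pseudomomentBound m a₁ a₂ s)
    (ha₁ : a₁ ∈ Set.Icc 0 ρ) (ha₂ : a₂ ∈ Set.Icc 0 ρ) (hρ : 2 * ρ ≤ Real.exp (-(1 / 2)))
    (hb : 0 ≤ b) (hfb : ∀ s, 1 ≤ |s| → ‖f s‖ ≤ b) :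
    Integrable fun s : ℝ => (f s ^ n - charFun (gaussianReal 0 1) s ^ n) / s := by
  refine (integrable_quotientMajorant (by lia) hn hf b).mono' ?_
    (.of_forall (norm_pow_sub_charFun_pow_div_le hm hn hclose ha₁ ha₂ hρ hb hfb))
  have hgauss : Measurable fun s => charFun (gaussianReal 0 1) s ^ n :=
    measurable_charFun.pow_const n
  exact ((hf.aestronglyMeasurable.aemeasurable.pow_const n).sub hgauss.aemeasurable).div
    Complex.measurable_ofReal.aemeasurable |>.aestronglyMeasurable

theorem abs_measureReal_Iio_sub_cdf_gaussianReal_le {κ : Measure ℝ} [IsProbabilityMeasure κ]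
    {b : ℝ} (hm : 3 ≤ m) (hn : 2 ≤ n) (hf : Integrable f)
    (hclose : ∀ s, ‖f s - charFun (gaussianReal 0 1) s‖ ≤ pseudomomentBound m a₁ a₂ s)
    (ha₁ : a₁ ∈ Set.Icc 0 ρ) (ha₂ : a₂ ∈ Set.Icc 0 ρ) (hρ : 2 * ρ ≤ Real.exp (-(1 / 2)))
    (hb : 0 ≤ b) (hfb : ∀ s, 1 ≤ |s| → ‖f s‖ ≤ b) (hκ : ∀ t, charFun κ t = f (t / √n) ^ n)
    (x : ℝ) :
    |κ.real (Set.Iio x) - cdf (gaussianReal 0 1) x| ≤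
      Pseudomoments.C1 m * a₁ / (n : ℝ) ^ (((m : ℝ) - 1) / 2)
      + Pseudomoments.C2 m * a₂ / (n : ℝ) ^ (((m : ℝ) - 2) / 2)
      + (∫ s, ‖f s‖) / Real.pi * b ^ (n - 1)
      + ρ * (4 / Real.pi) * (Real.exp (-(((n : ℝ) - 1) / 2)) / (n - 1)) := by
  set G : ℝ → ℂ := fun s => (f s ^ n - charFun (gaussianReal 0 1) s ^ n) / s
  have hsqrt : 0 < √(n : ℝ) := Real.sqrt_pos.2 (by exact_mod_cast (by lia : 0 < n))
  have hG : Integrable G :=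
    integrable_pow_sub_charFun_pow_div hm hn hf hclose ha₁ ha₂ hρ hb hfb
  have hscale (t : ℝ) : (charFun κ t - charFun (gaussianReal 0 1) t) / t =
      (√n : ℂ)⁻¹ * G (t / √n) := charFun_sub_charFun_gaussianReal_div_eq (by lia) hκ t
  have hnorm : ∫ t : ℝ, ‖(charFun κ t - charFun (gaussianReal 0 1) t) / t‖ = ∫ s, ‖G s‖ := by
    simp only [hscale, norm_mul, norm_inv, Complex.norm_real, Real.norm_of_nonneg hsqrt.le]
    rw [integral_const_mul, Measure.integral_comp_div (fun s => ‖G s‖), abs_of_pos hsqrt,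
      smul_eq_mul, inv_mul_cancel_left₀ hsqrt.ne']
  have hpi := Real.pi_pos
  rw [cdf_gaussianReal_eq_measureReal_Iio one_ne_zero]
  calc |κ.real (Set.Iio x) - (gaussianReal 0 1).real (Set.Iio x)|
      ≤ (∫ s, ‖G s‖) / Real.pi := hnorm ▸ abs_measureReal_Iio_sub_le_integral_norm_charFun_sub
        (by simpa only [hscale] using (hG.comp_div hsqrt.ne').const_mul _) x
    _ ≤ (∫ s, quotientMajorant f m n a₁ a₂ b ρ s) / Real.pi := by
        refine div_le_div_of_nonneg_right (integral_mono hG.norm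
          (integrable_quotientMajorant (by lia) hn hf b) fun s => ?_) hpi.le
        exact norm_pow_sub_charFun_pow_div_le hm hn hclose ha₁ ha₂ hρ hb hfb s
    _ = _ := by
        rw [integral_quotientMajorant (by lia) hn hf b]
        field_simp

end Comparison

/-! ### Pseudomoments -/

namespace Pseudomoments

theorem C1_nonneg (m : ℕ) : 0 ≤ C1 m := by
  have := Real.Gamma_pos_of_pos (s := ((m : ℝ) + 1) / 2) (by positivity)
  have := Real.pi_pos
  unfold C1
  positivity

theorem C2_nonneg (m : ℕ) : 0 ≤ C2 m := mul_nonneg two_pos.le (C1_nonneg _)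

theorem bConst_lt_one {A σ : ℝ} (hA : 0 < A) (hσ : 0 < σ) : bConst A σ < 1 := by
  have := Real.pi_pos
  rw [bConst, Real.exp_lt_one_iff, neg_lt_zero]
  positivity

theorem exp_neg_half_sub_one_div_le {x : ℝ} (hx : 2 ≤ x) :
    Real.exp (-((x - 1) / 2)) / (x - 1) ≤ Real.exp (3 / 2) * (Real.exp (-(x / 2)) / x) := by
  have hsplit : Real.exp (3 / 2) * Real.exp (-(x / 2)) =
      Real.exp 1 * Real.exp (-((x - 1) / 2)) := by
    rw [← Real.exp_add, ← Real.exp_add]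
    ring_nf
  have htwo : (2 : ℝ) ≤ Real.exp 1 := by linarith [Real.add_one_le_exp (1 : ℝ)]
  rw [← mul_div_assoc, hsplit, div_le_div_iff₀ (by linarith) (by linarith), mul_right_comm,
    mul_comm]
  gcongr
  nlinarith

theorem integrable_pow_gaussianReal (k : ℕ) :
    Integrable (fun x : ℝ => x ^ k) (gaussianReal 0 1) :=
  (memLp_id_gaussianReal (μ := 0) (v := 1) k).integrable_norm_pow'.mono (by fun_prop)
    (.of_forall fun x => by simp)

theorem integral_sq_gaussianReal : ∫ x, x ^ 2 ∂(gaussianReal 0 1) = 1 := by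
  have h := variance_fun_id_gaussianReal (μ := 0) (v := 1)
  rw [variance_of_integral_eq_zero (by fun_prop) integral_id_gaussianReal] at h
  simpa using h

section Law

variable {L : Measure ℝ} {σ : ℝ} {m n : ℕ}

theorem integral_norm_charFun_div (hσ : 0 < σ) :
    ∫ s, ‖charFun L (s / σ)‖ = σ * charFunL1 L := by
  rw [Measure.integral_comp_div (fun t => ‖charFun L t‖), abs_of_pos hσ, smul_eq_mul, charFunL1]

/-- The law of `ξ / σ`, where `ξ` has law `L`. -/
noncomputable def scaledLaw (L : Measure ℝ) (σ : ℝ) : Measure ℝ := L.map fun x => x / σ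

theorem charFun_scaledLaw (t : ℝ) : charFun (scaledLaw L σ) t = charFun L (t / σ) := by
  simpa only [scaledLaw, div_eq_inv_mul] using charFun_map_mul (μ := L) σ⁻¹ t

theorem memLp_scaledLaw (hL2 : MemLp id 2 L) : MemLp id 2 (scaledLaw L σ) := by
  rw [scaledLaw, memLp_map_measure_iff (by fun_prop) (by fun_prop)]
  simpa [Function.comp_def, div_eq_inv_mul] using hL2.const_mul σ⁻¹

theorem integral_pow_scaledLaw (k : ℕ) :
    ∫ x, x ^ k ∂(scaledLaw L σ) = (∫ x, x ^ k ∂L) / σ ^ k := by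
  rw [scaledLaw, integral_map (by fun_prop) (by fun_prop)]
  simp only [div_pow, integral_div]

variable [IsFiniteMeasure L]

instance : IsFiniteMeasure (scaledLaw L σ) := by
  unfold scaledLaw
  infer_instance

theorem nu1_nonneg : 0 ≤ nu1 L σ m n :=
  integral_nonneg fun _ => by positivity

theorem nu2_nonneg : 0 ≤ nu2 L σ m n :=
  integral_nonneg fun _ => by positivity

theorem integrable_pow_scaledLaw (hL2 : MemLp id 2 L)
    (hexists : ∀ k, 3 ≤ k → k ≤ m → (pseudoMeasure L σ).Integrable (fun x : ℝ => x ^ k))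
    {k : ℕ} (hk : k ≤ m) : Integrable (fun x : ℝ => x ^ k) (scaledLaw L σ) := by
  have h2 := memLp_scaledLaw (σ := σ) hL2
  rcases lt_or_ge k 3 with h | h
  · interval_cases k
    · simp
    · simp only [pow_one]
      exact h2.integrable one_le_two
    · exact h2.integrable_sq
  · exact (integrable_add_measure.2 ⟨hexists k h hk, integrable_pow_gaussianReal k⟩).mono_measure
      le_variation_toSignedMeasure_sub_add

theorem pseudomoment_eq_sub {k : ℕ} (hk : Integrable (fun x : ℝ => x ^ k) (scaledLaw L σ)) :
    pseudomoment L σ k = ∫ x, x ^ k ∂(scaledLaw L σ) - ∫ x, x ^ k ∂(gaussianReal 0 1) := by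
  have hgauss := integrable_pow_gaussianReal k
  rw [pseudomoment, show pseudoMeasure L σ =
      (scaledLaw L σ).toSignedMeasure - (gaussianReal 0 1).toSignedMeasure from rfl,
    VectorMeasure.integral_sub_vectorMeasure (by simpa [VectorMeasure.Integrable])
      (by simpa [VectorMeasure.Integrable]), VectorMeasure.integral_toSignedMeasure,
    VectorMeasure.integral_toSignedMeasure]

/-- The bound on the Kolmogorov distance between `Φ_n` and `Φ` for summands of law `L`, with half
the coefficients `2 C^{(1)}_m`, `2 C^{(2)}_m` of the paper and a sharper last term. -/
noncomputable def errorBound (L : Measure ℝ) [IsFiniteMeasure L] (σ : ℝ) (m n : ℕ) : ℝ :=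
  C1 m * nu1 L σ m n / (n : ℝ) ^ (((m : ℝ) - 1) / 2)
    + C2 m * nu2 L σ m n / (n : ℝ) ^ (((m : ℝ) - 2) / 2)
    + σ * charFunL1 L / Real.pi * bConst (charFunL1 L) σ ^ (n - 1)
    + nu L σ m n * (4 / Real.pi) * (Real.exp (-(((n : ℝ) - 1) / 2)) / (n - 1))

theorem errorBound_le (hn : 2 ≤ n) : errorBound L σ m n ≤
    2 * C1 m * nu1 L σ m n / (n : ℝ) ^ (((m : ℝ) - 1) / 2)
      + 2 * C2 m * nu2 L σ m n / (n : ℝ) ^ (((m : ℝ) - 2) / 2)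
      + σ * charFunL1 L / Real.pi * bConst (charFunL1 L) σ ^ (n - 1)
      + nu L σ m n * (4 * Real.exp (3 / 2) / Real.pi) * (Real.exp (-((n : ℝ) / 2)) / n) := by
  have hn' : (2 : ℝ) ≤ n := by exact_mod_cast hn
  have := Real.pi_pos
  have hν : 0 ≤ nu L σ m n := le_max_of_le_left nu1_nonneg
  have h₁ : 0 ≤ C1 m * nu1 L σ m n := mul_nonneg (C1_nonneg m) nu1_nonneg
  have h₂ : 0 ≤ C2 m * nu2 L σ m n := mul_nonneg (C2_nonneg m) nu2_nonneg
  have htail : nu L σ m n * (4 / Real.pi) * (Real.exp (-(((n : ℝ) - 1) / 2)) / (n - 1)) ≤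
      nu L σ m n * (4 * Real.exp (3 / 2) / Real.pi) * (Real.exp (-((n : ℝ) / 2)) / n) :=
    calc _ ≤ nu L σ m n * (4 / Real.pi) *
          (Real.exp (3 / 2) * (Real.exp (-((n : ℝ) / 2)) / n)) := by
          gcongr
          exact exp_neg_half_sub_one_div_le hn'
      _ = _ := by ring
  rw [errorBound, mul_assoc 2 (C1 m), mul_assoc 2 (C2 m)]
  gcongr ?_ / _ + ?_ / _ + _ + ?_ <;> linarith

variable [IsProbabilityMeasure L]

theorem integral_pow_scaledLaw_eq_gaussianReal (hσ : σ ≠ 0) (hL2 : MemLp id 2 L)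
    (hmean : ∫ x, x ∂L = 0) (hvar : Var[id; L] = σ ^ 2)
    (hexists : ∀ k, 3 ≤ k → k ≤ m → (pseudoMeasure L σ).Integrable (fun x : ℝ => x ^ k))
    (hzero : ∀ k, 3 ≤ k → k ≤ m → pseudomoment L σ k = 0) {k : ℕ} (hk : k ≤ m) :
    ∫ x, x ^ k ∂(scaledLaw L σ) = ∫ x, x ^ k ∂(gaussianReal 0 1) := by
  rcases lt_or_ge k 3 with h | h
  · rw [variance_of_integral_eq_zero aemeasurable_id hmean] at hvar
    rw [integral_pow_scaledLaw]
    interval_cases k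
    · simp
    · simp [hmean]
    · simpa [integral_sq_gaussianReal, hσ, div_eq_iff] using hvar
  · exact sub_eq_zero.1 ((pseudomoment_eq_sub (integrable_pow_scaledLaw hL2 hexists hk)).symm.trans
      (hzero k h hk))

theorem norm_charFun_div_sub_charFun_gaussianReal_le (hσ : σ ≠ 0) (hL2 : MemLp id 2 L)
    (hmean : ∫ x, x ∂L = 0) (hvar : Var[id; L] = σ ^ 2)
    (hexists : ∀ k, 3 ≤ k → k ≤ m → (pseudoMeasure L σ).Integrable (fun x : ℝ => x ^ k))
    (hzero : ∀ k, 3 ≤ k → k ≤ m → pseudomoment L σ k = 0) (n : ℕ) (t : ℝ) :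
    ‖charFun L (t / σ) - charFun (gaussianReal 0 1) t‖ ≤
      pseudomomentBound m (nu1 L σ m n) (nu2 L σ m n) t := by
  rw [← charFun_scaledLaw]
  exact norm_charFun_sub_charFun_le (fun _ => integrable_pow_scaledLaw hL2 hexists)
    (fun k _ => integrable_pow_gaussianReal k)
    (fun _ => integral_pow_scaledLaw_eq_gaussianReal hσ hL2 hmean hvar hexists hzero) (σ * √n) t

theorem abs_measureReal_Iio_sub_stdNormalCDF_le {κ : Measure ℝ} [IsProbabilityMeasure κ]
    (hσ : 0 < σ) (hL2 : MemLp id 2 L) (hmean : ∫ x, x ∂L = 0) (hvar : Var[id; L] = σ ^ 2)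
    (hchar : Integrable (charFun L)) (hm : 3 ≤ m)
    (hexists : ∀ k, 3 ≤ k → k ≤ m → (pseudoMeasure L σ).Integrable (fun x : ℝ => x ^ k))
    (hzero : ∀ k, 3 ≤ k → k ≤ m → pseudomoment L σ k = 0) (hn : 2 ≤ n)
    (hν : nu L σ m n ≤ 1 / 2 * Real.exp (-(1 / 2)))
    (hκ : ∀ t, charFun κ t = charFun L (t / √n / σ) ^ n) (x : ℝ) :
    |κ.real (Set.Iio x) - stdNormalCDF x| ≤ errorBound L σ m n := by
  have hfar (s : ℝ) (hs : 1 ≤ |s|) : ‖charFun L (s / σ)‖ ≤ bConst (charFunL1 L) σ :=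
    norm_charFun_le_bConst hchar hL2 hσ hvar.le
      (by rwa [abs_div, abs_of_pos hσ, mul_div_cancel₀ _ hσ.ne'])
  have hρ : 2 * nu L σ m n ≤ Real.exp (-(1 / 2)) := by linarith
  rw [errorBound, ← integral_norm_charFun_div hσ]
  exact abs_measureReal_Iio_sub_cdf_gaussianReal_le hm hn (hchar.comp_div hσ.ne')
    (norm_charFun_div_sub_charFun_gaussianReal_le hσ.ne' hL2 hmean hvar hexists hzero n)
    ⟨nu1_nonneg, le_max_left _ _⟩ ⟨nu2_nonneg, le_max_right _ _⟩ hρ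
    (Real.exp_nonneg _) hfar hκ x

end Law

section Sum

variable {Ω : Type*} [MeasurableSpace Ω] {P : Measure Ω} {ξ : ℕ → Ω → ℝ}

theorem aemeasurable_normalized_sum (hξ : ∀ i, AEMeasurable (ξ i) P) (σ : ℝ) (n : ℕ) :
    AEMeasurable (fun ω => (σ * √(n : ℝ))⁻¹ * ∑ i ∈ Finset.range n, ξ i ω) P :=
  (Finset.aemeasurable_fun_sum _ fun i _ => hξ i).const_mul _

theorem sumCDF_eq_measureReal_map (hξ : ∀ i, AEMeasurable (ξ i) P) (σ : ℝ) (n : ℕ) (x : ℝ) :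
    sumCDF P ξ σ n x =
      (P.map fun ω => (σ * √(n : ℝ))⁻¹ * ∑ i ∈ Finset.range n, ξ i ω).real (Set.Iio x) :=
  (map_measureReal_apply_of_aemeasurable (aemeasurable_normalized_sum hξ σ n)
    measurableSet_Iio).symm

theorem charFun_map_normalized_sum (hindep : iIndepFun ξ P)
    (hident : ∀ i, IdentDistrib (ξ i) (ξ 0) P P) (σ : ℝ) (n : ℕ) (t : ℝ) :
    charFun (P.map fun ω => (σ * √(n : ℝ))⁻¹ * ∑ i ∈ Finset.range n, ξ i ω) t =
      charFun (P.map (ξ 0)) (t / √n / σ) ^ n := by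
  have hsum : AEMeasurable (fun ω => ∑ i ∈ Finset.range n, ξ i ω) P :=
    Finset.aemeasurable_fun_sum _ fun i _ => (hident i).aemeasurable_fst
  have h := charFun_inv_sqrt_mul_sum hindep hident (n := n) (t := t / σ)
  rw [charFun_map_mul_comp hsum] at h
  rw [charFun_map_mul_comp hsum, div_right_comm, div_eq_inv_mul (t / σ), ← h]
  ring_nf

end Sum

end Pseudomoments

theorem theorem1_general {Ω : Type*} [MeasurableSpace Ω] (P : Measure Ω) [IsProbabilityMeasure P]
    (ξ : ℕ → Ω → ℝ) (hindep : iIndepFun ξ P) (hident : ∀ i, IdentDistrib (ξ i) (ξ 0) P P)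
    (hL2 : MemLp (ξ 0) 2 P) (hmean : ∫ ω, ξ 0 ω ∂P = 0)
    (σ : ℝ) (hσ : 0 < σ) (hvar : variance (ξ 0) P = σ ^ 2)
    (hchar : Integrable (fun t : ℝ => charFun (P.map (ξ 0)) t)) (m : ℕ) (hm : 3 ≤ m)
    (hexists : ∀ k, 3 ≤ k → k ≤ m →
      (Pseudomoments.pseudoMeasure (P.map (ξ 0)) σ).Integrable (fun x : ℝ => x ^ k))
    (hzero : ∀ k, 3 ≤ k → k ≤ m → Pseudomoments.pseudomoment (P.map (ξ 0)) σ k = 0) :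
    Pseudomoments.bConst (Pseudomoments.charFunL1 (P.map (ξ 0))) σ < 1 ∧
    ∀ n : ℕ, 2 ≤ n →
      Pseudomoments.nu (P.map (ξ 0)) σ m n ≤ 1 / 2 * Real.exp (-(1 / 2)) →
      (⨆ x : ℝ, |Pseudomoments.sumCDF P ξ σ n x - Pseudomoments.stdNormalCDF x|) ≤
        Pseudomoments.errorBound (P.map (ξ 0)) σ m n := by
  have hξ (i : ℕ) : AEMeasurable (ξ i) P := (hident i).aemeasurable_fst
  have : IsProbabilityMeasure (P.map (ξ 0)) := Measure.isProbabilityMeasure_map (hξ 0)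
  refine ⟨Pseudomoments.bConst_lt_one (integral_norm_charFun_pos hchar) hσ,
    fun n hn hν => ciSup_le fun x => ?_⟩
  have := Measure.isProbabilityMeasure_map (Pseudomoments.aemeasurable_normalized_sum hξ σ n)
  rw [Pseudomoments.sumCDF_eq_measureReal_map hξ]
  exact Pseudomoments.abs_measureReal_Iio_sub_stdNormalCDF_le hσ
    ((memLp_map_measure_iff (by fun_prop) (hξ 0)).2 hL2)
    ((integral_map (hξ 0) (by fun_prop)).trans hmean) ((variance_id_map (hξ 0)).trans hvar)
    hchar hm hexists hzero hn hν (Pseudomoments.charFun_map_normalized_sum hindep hident σ n) x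

theorem theorem1 {Ω : Type*} [MeasurableSpace Ω] (P : Measure Ω) [IsProbabilityMeasure P]
    (ξ : ℕ → Ω → ℝ) (hmeas : ∀ i, Measurable (ξ i)) (hindep : iIndepFun ξ P)
    (hident : ∀ i, IdentDistrib (ξ i) (ξ 0) P P)
    (hL2 : MemLp (ξ 0) 2 P) (hmean : ∫ ω, ξ 0 ω ∂P = 0)
    (σ : ℝ) (hσ : 0 < σ) (hvar : variance (ξ 0) P = σ ^ 2)
    -- (i) integrability of the characteristic function
    (hchar : Integrable (fun t : ℝ => charFun (P.map (ξ 0)) t))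
    -- (ii) the pseudomoments of orders `3, …, m` exist and vanish
    (m : ℕ) (hm : 3 ≤ m)
    (hexists : ∀ k, 3 ≤ k → k ≤ m →
      (Pseudomoments.pseudoMeasure (P.map (ξ 0)) σ).Integrable (fun x : ℝ => x ^ k))
    (hzero : ∀ k, 3 ≤ k → k ≤ m → Pseudomoments.pseudomoment (P.map (ξ 0)) σ k = 0) :
    Pseudomoments.bConst (Pseudomoments.charFunL1 (P.map (ξ 0))) σ < 1 ∧
    ∀ n : ℕ, 2 ≤ n →
      Pseudomoments.nu (P.map (ξ 0)) σ m n < 1 / 2 * Real.exp (-(3 / 2)) →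
      (⨆ x : ℝ, |Pseudomoments.sumCDF P ξ σ n x - Pseudomoments.stdNormalCDF x|) ≤
        2 * Pseudomoments.C1 m * Pseudomoments.nu1 (P.map (ξ 0)) σ m n
            / (n : ℝ) ^ (((m : ℝ) - 1) / 2)
        + 2 * Pseudomoments.C2 m * Pseudomoments.nu2 (P.map (ξ 0)) σ m n
            / (n : ℝ) ^ (((m : ℝ) - 2) / 2)
        + σ * Pseudomoments.charFunL1 (P.map (ξ 0)) / Real.pi
            * Pseudomoments.bConst (Pseudomoments.charFunL1 (P.map (ξ 0))) σ ^ (n - 1)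
        + Pseudomoments.nu (P.map (ξ 0)) σ m n * (4 * Real.exp (3 / 2) / Real.pi)
            * (Real.exp (-((n : ℝ) / 2)) / (n : ℝ)) :=
  (theorem1_general P ξ hindep hident hL2 hmean σ hσ hvar hchar m hm hexists hzero).imp_right
    fun h n hn hν =>
      (h n hn (hν.le.trans (by gcongr; norm_num))).trans (Pseudomoments.errorBound_le hn)
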